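/- Let $S^{N-1}(\sqrt N)\subset\mathbb R^N$ be the Euclidean sphere of radius $\sqrt N$ centred at the origin, $\sigma^N$ its uniform probability measure, $\gamma$ the standard Gaussian measure on $\mathbb R$, and $H(\mu|\nu)=\int \log\frac{d\mu}{d\nu}\,d\mu\in[0,\infty]$ the relative entropy of probability measures ($+\infty$ if $\mu\not\ll\nu$). For a probability measure $\mu^{(N)}$ on $S^{N-1}(\sqrt N)$ and $1\le k\le N$, let $P_k\mu^{(N)}$ be its marginal on the first $k$ coordinates. A family $\{\mu^{(N)}\}_{N\ge N_0}$, where $N_0\ge 1$ and $\mu^{(N)}$ is a probability measure on $S^{N-1}(\sqrt N)$, is called *entropically $\mu$-chaotic* ($\mu$ a Borel probability measure on $\mathbb R$) if (i) each $\mu^{(N)}$ is invariant under permutations of the coordinates $v_1,\dots,v_N$; (ii) for every $k\ge 1$, $P_k\mu^{(N)}\to\mu^{\otimes k}$ as $N\to\infty$, weakly against bounded continuous functions on $\mathbb R^k$; (iii) $\displaystyle\lim_{N\to\infty}\frac{H(\mu^{(N)}|\sigma^N)}{N}=H(\mu|\gamma)$. Let $f$ be a probability density on $\mathbb R$ with $$\int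 f(v)v^2\,dv=1,\qquad \int f(v)v^4\,dv<\infty,\qquad f\in L^\infty(\mathbb R),$$ let $\mu(dv)=f(v)\,dv$, and put $$Z_N=\int_{S^{N-1}(\sqrt N)}\prod_{j=1}^N f(v_j)\,d\sigma^N(v),\qquad [\mu^{\otimes N}]=\frac{\prod_{j=1}^N f(v_j)}{Z_N}\,\sigma^N .$$ Then there is $N_0\ge 1$ such that $0<Z_N<\infty$ for all $N\ge N_0$ (so that $[\mu^{\otimes N}]$ is a well-defined probability measure on $S^{N-1}(\sqrt N)$ for these $N$), and the family $\{[\mu^{\otimes N}]\}_{N\ge N_0}$ is entropically $\mu$-chaotic. In fact, for every $k\ge1$, $$\lim_{N\to\infty}H\bigl(P_k[\mu^{\otimes N}]\,\big|\,\mu^{\otimes k}\bigr)=0 .$$ Furthermore, for every $N_1\ge1$, any family $\{\mu^{(N)}\}_{N\ge N_1}$ of permutation-symmetric probability measures on $S^{N-1}(\sqrt N)$ with $$\frac1N H\bigl(\mu^{(N)}\,\big|\,[\mu^{\otimes N}]\bigr)\longrightarrow 0\qquad(N\to\infty)$$ is entropically $\mu$-chaotic. -/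

import Mathlib

namespace KacChaos

open MeasureTheory

noncomputable section

/-- The sphere `S^{N-1}(√N)` in `ℝ^N` with its Euclidean norm. -/
abbrev KacSphere (N : ℕ) : Type :=
  Metric.sphere (0 : EuclideanSpace ℝ (Fin N)) (Real.sqrt (N : ℝ))

/-- The dilation by `√N` from the unit sphere onto `S^{N-1}(√N)`. -/
def dilate (N : ℕ) (x : Metric.sphere (0 : EuclideanSpace ℝ (Fin N)) 1) : KacSphere N :=
  ⟨Real.sqrt (N : ℝ) • (x : EuclideanSpace ℝ (Fin N)), by
    rw [mem_sphere_zero_iff_norm, norm_smul, norm_eq_of_mem_sphere x, mul_one,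
      Real.norm_of_nonneg (Real.sqrt_nonneg _)]⟩

/-- The surface measure of the unit sphere of `ℝ^N`. -/
def surfaceMeasure (N : ℕ) : Measure (Metric.sphere (0 : EuclideanSpace ℝ (Fin N)) 1) :=
  (volume : Measure (EuclideanSpace ℝ (Fin N))).toSphere

/-- The uniform probability measure `σ^N` on `S^{N-1}(√N)` (for `N ≥ 1`): the image under the
dilation of the normalized surface measure of the unit sphere. -/
def unif (N : ℕ) : Measure (KacSphere N) :=
  (((surfaceMeasure N) Set.univ)⁻¹ • surfaceMeasure N).map (dilate N)

/-- The measure `f(v) dv` on `ℝ`. -/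
def density (f : ℝ → ℝ) : Measure ℝ :=
  volume.withDensity fun v => ENNReal.ofReal (f v)

/-- The tensor power `μ^{⊗k}` on `ℝ^k`. -/
def tensorPower (μ : Measure ℝ) (k : ℕ) : Measure (Fin k → ℝ) :=
  Measure.pi fun _ => μ

/-- The normalization `Z_N(f, √N)`, the integral of `f^{⊗N}` over `S^{N-1}(√N)` against `σ^N`. -/
def Z (f : ℝ → ℝ) (N : ℕ) : ENNReal :=
  ∫⁻ v : KacSphere N, ∏ j : Fin N, ENNReal.ofReal (f (v.1 j)) ∂(unif N)

/-- The conditioned tensor product `[μ^{⊗N}]` on `S^{N-1}(√N)`, for `μ = f(v) dv`. It is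
meaningful when `0 < Z f N < ∞`. -/
def condProd (f : ℝ → ℝ) (N : ℕ) : Measure (KacSphere N) :=
  (unif N).withDensity fun v => (∏ j : Fin N, ENNReal.ofReal (f (v.1 j))) / Z f N

/-- The marginal `P_k` of a measure on `S^{N-1}(√N)` for the first `k` velocities
(the case `k > N`, where there is no such marginal, is given the value `0`). -/
def marginal {N : ℕ} (k : ℕ) (m : Measure (KacSphere N)) : Measure (Fin k → ℝ) :=
  if h : k ≤ N then m.map fun v i => v.1 (Fin.castLE h i) else 0

/-- Invariance under interchange of the variables: for every permutation `π`, the law of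
`(v_{π 1}, …, v_{π N})` is the law of `(v_1, …, v_N)`. -/
def IsSymm {N : ℕ} (m : Measure (KacSphere N)) : Prop :=
  ∀ π : Equiv.Perm (Fin N),
    m.map (fun v (i : Fin N) => v.1 (π i)) = m.map (fun v (i : Fin N) => v.1 i)

/-- The family `(m N)`, `N ≥ N₀`, consists of symmetric probability measures on the spheres
`S^{N-1}(√N)`. -/
def IsSymmFamily (N₀ : ℕ) (m : (N : ℕ) → Measure (KacSphere N)) : Prop :=
  ∀ N, N₀ ≤ N → IsProbabilityMeasure (m N) ∧ IsSymm (m N)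

/-- The family `(m N)`, `N ≥ N₀`, of probability measures on `S^{N-1}(√N)` is `μ`-chaotic. -/
structure IsChaotic (μ : Measure ℝ) (N₀ : ℕ) (m : (N : ℕ) → Measure (KacSphere N)) : Prop where
  symm : IsSymmFamily N₀ m
  tendsto : ∀ k : ℕ, 0 < k → ∀ χ : BoundedContinuousFunction (Fin k → ℝ) ℝ,
    Filter.Tendsto (fun N : ℕ => ∫ v, χ v ∂(marginal k (m N))) Filter.atTop
      (nhds (∫ v, χ v ∂(tensorPower μ k)))

/-- The family `(m N)`, `N ≥ N₀`, of probability measures on `S^{N-1}(√N)` is entropically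
`μ`-chaotic. Relative entropy `H(·|·)` between probability measures is
`InformationTheory.klDiv`, with values in `[0, ∞]`. -/
structure IsEntropicallyChaotic (μ : Measure ℝ) (N₀ : ℕ)
    (m : (N : ℕ) → Measure (KacSphere N)) : Prop extends IsChaotic μ N₀ m where
  entropy : Filter.Tendsto (fun N : ℕ => InformationTheory.klDiv (m N) (unif N) / (N : ENNReal))
    Filter.atTop (nhds (InformationTheory.klDiv μ (ProbabilityTheory.gaussianReal 0 1)))

end

end KacChaos

/-!
Under the conditioning the sum of the `v_j ^ 2` equals its mean `N`, so `Z_N` is a value of the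
density of a sum of `N` independent squares. The local central limit theorem evaluates it, and it
shows that the density of the `k`-th marginal with respect to `μ^{⊗k}` is bounded and converges
to `1`; hence the marginal entropies tend to `0`.

If `H(m_N | [μ^{⊗N}]) = o(N)`, split the coordinates into `⌊N / k⌋` blocks of length `k` and apply
the Donsker–Varadhan inequality to the sum over the blocks of one test function. Symmetry makes
this a bound on a single expectation, in which the entropy is divided by the number of blocks, and
the exponential moment is at most a constant times that of independent blocks. Letting `N` grow
and then scaling the test function by `t → 0` gives the convergence of the expectations. The
argument only needs exponential moments, so it also covers the unbounded test function `log f`,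
which turns the entropy relative to `[μ^{⊗N}]` into the entropy relative to `σ^N`. The remaining
constant `lim log Z_N / N` is found by comparison with the Gaussian, whose tensor power is constant
on the sphere.
-/

namespace KacChaos

open MeasureTheory Filter Topology ProbabilityTheory
open scoped ENNReal NNReal Real FourierTransform SchwartzMap

noncomputable section

section Fourier

variable {V E : Type*} [NormedAddCommGroup V] [InnerProductSpace ℝ V] [FiniteDimensional ℝ V]
  [MeasurableSpace V] [BorelSpace V]

lemma ae_eq_of_forall_integral_schwartzMap_smul_eq [NormedAddCommGroup E] [NormedSpace ℂ E]
    [CompleteSpace E] {f f' : V → E} (hf : LocallyIntegrable f) (hf' : LocallyIntegrable f')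
    (h : ∀ g : 𝓢(V, ℂ), ∫ x, g x • f x = ∫ x, g x • f' x) : f =ᵐ[volume] f' := by
  refine ae_eq_of_integral_contDiff_smul_eq hf hf' fun g hg hgc => ?_
  have hgc' : HasCompactSupport (fun x => (g x : ℂ)) := hgc.comp_left (g := Complex.ofReal) rfl
  simpa using! h (hgc'.toSchwartzMap (Complex.ofRealCLM.contDiff.comp hg))

lemma integral_schwartzMap_fourier_smul_eq [NormedAddCommGroup E] [NormedSpace ℂ E]
    [CompleteSpace E] (g : 𝓢(V, ℂ)) {f : V → E} (hf : Integrable f) :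
    ∫ ξ, (𝓕 g) ξ • f ξ = ∫ x, g x • 𝓕 f x := by
  simpa [SchwartzMap.fourier_coe] using! VectorFourier.integral_fourierIntegral_smul_eq_flip
    (L := innerₗ V) Real.continuous_fourierChar continuous_inner g.integrable hf

lemma continuous_fourier [NormedAddCommGroup E] [NormedSpace ℂ E] {f : V → E}
    (hf : Integrable f) : Continuous (𝓕 f) :=
  VectorFourier.fourierIntegral_continuous Real.continuous_fourierChar
    (by exact continuous_inner) hf

lemma fourier_fourierInv_ae_eq [NormedAddCommGroup E] [NormedSpace ℂ E] [CompleteSpace E]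
    {f : V → E} (hf : Integrable f) (hf' : Integrable (𝓕⁻ f)) : 𝓕 (𝓕⁻ f) =ᵐ[volume] f := by
  refine ae_eq_of_forall_integral_schwartzMap_smul_eq (continuous_fourier hf').locallyIntegrable
    hf.locallyIntegrable fun g => ?_
  calc ∫ x, g x • 𝓕 (𝓕⁻ f) x = ∫ ξ, (𝓕 g) ξ • 𝓕⁻ f ξ :=
        (integral_schwartzMap_fourier_smul_eq g hf').symm
    _ = ∫ ξ, (𝓕⁻ g) ξ • 𝓕 f ξ := by
        rw [← integral_neg_eq_self]
        simp only [Real.fourierInv_eq_fourier_neg, neg_neg, SchwartzMap.fourierInv_coe,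
          SchwartzMap.fourier_coe]
    _ = ∫ x, g x • f x := by
        rw [← integral_schwartzMap_fourier_smul_eq _ hf, FourierTransform.fourier_fourierInv_eq]

lemma memLp_two_fourier [NormedAddCommGroup E] [InnerProductSpace ℂ E] [CompleteSpace E]
    {f : V → E} (hf : Integrable f) (hf2 : MemLp f 2) : MemLp (𝓕 f) 2 := by
  have hae : (𝓕 (hf2.toLp f) : Lp E 2 (volume : Measure V)) =ᵐ[volume] 𝓕 f := by
    refine ae_eq_of_forall_integral_schwartzMap_smul_eq
      ((Lp.memLp _).locallyIntegrable one_le_two) (continuous_fourier hf).locallyIntegrable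
      fun g => ?_
    rw [← integral_schwartzMap_fourier_smul_eq g hf, ← Lp.toTemperedDistribution_apply,
      ← Lp.fourier_toTemperedDistribution_eq, TemperedDistribution.fourier_apply,
      Lp.toTemperedDistribution_apply]
    refine integral_congr_ae ?_
    filter_upwards [hf2.coeFn_toLp] with x hx
    rw [hx]
  exact (memLp_congr_ae hae).1 (Lp.memLp _)

variable (ν : Measure V) [IsFiniteMeasure ν]

lemma charFun_eq_fourierInv_rnDeriv (hν : ν ≪ volume) (t : V) :
    charFun ν t = 𝓕⁻ (fun x => ((ν.rnDeriv volume x).toReal : ℂ)) ((2 * π)⁻¹ • t) := by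
  rw [charFun_apply, Real.fourierInv_eq', ← integral_rnDeriv_smul hν]
  refine integral_congr_ae (ae_of_all _ fun x => ?_)
  simp only [real_inner_smul_right, Complex.real_smul, smul_eq_mul]
  rw [mul_comm, mul_inv_cancel_left₀ (by positivity)]

lemma tendsto_charFun_cocompact (hν : ν ≪ volume) :
    Tendsto (charFun ν) (cocompact V) (𝓝 0) := by
  have hc : Tendsto (fun t : V => -((2 * π)⁻¹ • t)) (cocompact V) (cocompact V) :=
    ((Homeomorph.smulOfNeZero (2 * π)⁻¹ (by positivity)).trans
      (Homeomorph.neg V)).isClosedEmbedding.tendsto_cocompact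
  refine ((tendsto_integral_exp_inner_smul_cocompact
    fun x => ((ν.rnDeriv volume x).toReal : ℂ)).comp hc).congr fun t => ?_
  rw [charFun_eq_fourierInv_rnDeriv ν hν, Real.fourierInv_eq_fourier_neg, Real.fourier_eq]
  rfl

lemma memLp_two_toReal_rnDeriv_of_le_smul {K : ℝ≥0∞} (hK : K ≠ ∞) (hν : ν ≤ K • volume) :
    MemLp (fun x => ((ν.rnDeriv volume x).toReal : ℂ)) 2 := by
  have hle : ν.rnDeriv volume ≤ᵐ[volume] fun _ => K :=
    ae_le_of_forall_setLIntegral_le_of_sigmaFinite (ν.measurable_rnDeriv volume) fun s _ _ => by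
      rw [setLIntegral_const, ← smul_eq_mul, ← Measure.smul_apply]
      exact (Measure.setLIntegral_rnDeriv_le s).trans (hν s)
  have hint : Integrable (fun x => ((ν.rnDeriv volume x).toReal : ℂ)) :=
    Measure.integrable_toReal_rnDeriv.ofReal
  rw [memLp_two_iff_integrable_sq_norm hint.1]
  refine (hint.norm.const_mul K.toReal).mono' (hint.1.norm.pow 2) ?_
  filter_upwards [hle] with x hx
  rw [norm_pow, norm_norm, sq, Complex.norm_real, Real.norm_of_nonneg ENNReal.toReal_nonneg]
  gcongr

lemma memLp_two_charFun_of_le_smul {K : ℝ≥0∞} (hK : K ≠ ∞) (hν : ν ≤ K • volume) :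
    MemLp (charFun ν) 2 := by
  have hac : ν ≪ volume := (Measure.absolutelyContinuous_of_le hν).trans
    Measure.smul_absolutelyContinuous
  have hF : MemLp (𝓕 fun x => ((ν.rnDeriv volume x).toReal : ℂ)) 2 :=
    memLp_two_fourier Measure.integrable_toReal_rnDeriv.ofReal
      (memLp_two_toReal_rnDeriv_of_le_smul ν hK hν)
  rw [memLp_two_iff_integrable_sq_norm hF.1] at hF
  have hcont : Continuous (charFun ν) := by fun_prop
  rw [memLp_two_iff_integrable_sq_norm hcont.aestronglyMeasurable]
  refine (hF.comp_smul (R := -(2 * π)⁻¹) (neg_ne_zero.2 (by positivity))).congr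
    (ae_of_all _ fun t => ?_)
  simp only [charFun_eq_fourierInv_rnDeriv ν hac, Real.fourierInv_eq_fourier_neg, neg_smul]

lemma integrable_norm_charFun_pow_four_of_conv_le_smul {K : ℝ≥0∞} (hK : K ≠ ∞)
    (hν : ν ∗ ν ≤ K • volume) : Integrable (fun t => ‖charFun ν t‖ ^ 4) := by
  have h := memLp_two_charFun_of_le_smul (ν ∗ ν) hK hν
  rw [memLp_two_iff_integrable_sq_norm h.1] at h
  refine h.congr (ae_of_all _ fun t => ?_)
  simp only [charFun_conv, norm_mul]
  ring

end Fourier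

section Inversion

/-- The real part of the inverse Fourier transform of `φ`, in the normalization for which the
density of a law with characteristic function `φ` is `invDensity φ`. -/
def invDensity (φ : ℝ → ℂ) (u : ℝ) : ℝ :=
  (2 * π)⁻¹ * (∫ ξ : ℝ, Complex.exp (-(u * ξ : ℝ) * Complex.I) * φ ξ).re

lemma norm_exp_neg_mul_I (x : ℝ) : ‖Complex.exp (-(x : ℂ) * Complex.I)‖ = 1 := by
  rw [← Complex.ofReal_neg, Complex.norm_exp_ofReal_mul_I]

lemma continuous_invDensity {φ : ℝ → ℂ} (hφ : Integrable φ) : Continuous (invDensity φ) := by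
  unfold invDensity
  refine continuous_const.mul (Complex.continuous_re.comp ?_)
  refine continuous_of_dominated (bound := fun ξ => ‖φ ξ‖) (fun u => ?_) (fun u => ?_) hφ.norm ?_
  · exact (Continuous.aestronglyMeasurable (by fun_prop)).mul hφ.1
  · exact ae_of_all _ fun ξ => by rw [norm_mul, norm_exp_neg_mul_I, one_mul]
  · exact ae_of_all _ fun ξ => by fun_prop

lemma invDensity_eq_re_fourier (φ : ℝ → ℂ) (u : ℝ) :
    invDensity φ u = (𝓕 (fun ξ : ℝ => φ (2 * π * ξ)) u).re := by
  have hscale := Measure.integral_comp_mul_left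
    (fun ξ : ℝ => Complex.exp (-(u * ξ : ℝ) * Complex.I) * φ ξ) (2 * π)
  rw [abs_of_pos (by positivity)] at hscale
  rw [invDensity, Real.fourier_real_eq_integral_exp_smul, ← Complex.re_ofReal_mul,
    ← Complex.real_smul, ← hscale]
  congr 2 with ξ
  rw [smul_eq_mul]
  congr 2
  push_cast
  ring

theorem eq_withDensity_invDensity (ν : Measure ℝ) [IsFiniteMeasure ν] (hac : ν ≪ volume)
    (h : Integrable (charFun ν)) :
    ν = volume.withDensity (fun u => ENNReal.ofReal (invDensity (charFun ν) u)) := by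
  have hscale : 𝓕⁻ (fun x => ((ν.rnDeriv volume x).toReal : ℂ)) =
      fun ξ => charFun ν (2 * π * ξ) := by
    ext ξ
    rw [charFun_eq_fourierInv_rnDeriv ν hac, smul_eq_mul, inv_mul_cancel_left₀ (by positivity)]
  have hint : Integrable (fun x => ((ν.rnDeriv volume x).toReal : ℂ)) :=
    Measure.integrable_toReal_rnDeriv.ofReal
  conv_lhs => rw [← Measure.withDensity_rnDeriv_eq ν volume hac]
  refine withDensity_congr_ae ?_
  filter_upwards [fourier_fourierInv_ae_eq hint (hscale ▸ h.comp_mul_left' (by positivity)),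
    ν.rnDeriv_lt_top volume] with x hx hx_lt_top
  rw [invDensity_eq_re_fourier, ← hscale, hx, Complex.ofReal_re, ENNReal.ofReal_toReal hx_lt_top.ne]

end Inversion

section CharFunBounds

variable {V : Type*} [NormedAddCommGroup V] [InnerProductSpace ℝ V] [FiniteDimensional ℝ V]
  [MeasurableSpace V] (ν : Measure V) [IsProbabilityMeasure ν]

/-- If `‖charFun ν ξ‖ = 1`, then `exp (i⟨x, ξ⟩)` is a.e. a constant `c` of modulus one, and
`charFun ν (kξ) = c ^ k` does not tend to zero. -/
lemma norm_charFun_lt_one_of_tendsto_zero (hz : Tendsto (charFun ν) (cocompact V) (𝓝 0)) {ξ : V}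
    (hξ : ξ ≠ 0) : ‖charFun ν ξ‖ < 1 := by
  have hle : ∀ᵐ x ∂ν, ‖Complex.exp (inner ℝ x ξ * Complex.I)‖ ≤ 1 :=
    ae_of_all _ fun x => (Complex.norm_exp_ofReal_mul_I _).le
  rcases ae_eq_const_or_norm_integral_lt_of_norm_le_const hle with hconst | hlt
  · exfalso
    generalize (⨍ x, Complex.exp (inner ℝ x ξ * Complex.I) ∂ν) = c at hconst
    have hc : ‖c‖ = 1 := by
      obtain ⟨x, hx⟩ := hconst.exists
      rw [← show Function.const V c x = c from rfl, ← hx, Complex.norm_exp_ofReal_mul_I]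
    have hpow (k : ℕ) : charFun ν (k • ξ) = c ^ k := by
      have hae : (fun x => Complex.exp (inner ℝ x (k • ξ) * Complex.I)) =ᵐ[ν] fun _ => c ^ k := by
        filter_upwards [hconst] with x hx
        rw [← show Function.const V c x = c from rfl, ← hx, ← Complex.exp_nat_mul,
          ← Nat.cast_smul_eq_nsmul ℝ, real_inner_smul_right]
        push_cast
        ring_nf
      rw [charFun_apply, integral_congr_ae hae, integral_const, probReal_univ, one_smul]
    have hk : Tendsto (fun k : ℕ => k • ξ) atTop (cocompact V) := by
      rw [← Metric.cobounded_eq_cocompact, ← tendsto_norm_atTop_iff_cobounded]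
      simp only [← Nat.cast_smul_eq_nsmul ℝ, norm_smul, Real.norm_natCast]
      exact tendsto_natCast_atTop_atTop.atTop_mul_const (norm_pos_iff.2 hξ)
    have hlim := (hz.comp hk).norm
    simp only [Function.comp_def, hpow, norm_pow, hc, one_pow, norm_zero] at hlim
    exact one_ne_zero (tendsto_nhds_unique tendsto_const_nhds hlim)
  · simpa [charFun_apply] using hlt

lemma exists_norm_charFun_le_lt_one [BorelSpace V]
    (hz : Tendsto (charFun ν) (cocompact V) (𝓝 0)) {δ : ℝ} (hδ : 0 < δ) :
    ∃ κ, 0 ≤ κ ∧ κ < 1 ∧ ∀ ξ, δ ≤ ‖ξ‖ → ‖charFun ν ξ‖ ≤ κ := by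
  obtain ⟨R, -, hR⟩ := (Metric.hasBasis_cobounded_compl_closedBall (0 : V)).eventually_iff.1
    (Metric.cobounded_eq_cocompact (α := V) ▸
      hz.norm.eventually_le_const (u := 1 / 2) (by norm_num))
  have hK : IsCompact (Metric.closedBall (0 : V) R ∩ {ξ | δ ≤ ‖ξ‖}) :=
    (isCompact_closedBall 0 R).inter_right (isClosed_le continuous_const continuous_norm)
  have hcont : Continuous (fun ξ => ‖charFun ν ξ‖) := by fun_prop
  obtain ⟨κ, hκ1, hκ⟩ :
      ∃ κ < 1, ∀ ξ ∈ Metric.closedBall (0 : V) R ∩ {ξ | δ ≤ ‖ξ‖}, ‖charFun ν ξ‖ ≤ κ := by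
    rcases (Metric.closedBall (0 : V) R ∩ {ξ | δ ≤ ‖ξ‖}).eq_empty_or_nonempty with he | hne
    · exact ⟨0, by norm_num, by simp [he]⟩
    · obtain ⟨ξ₀, ⟨-, hξ₀⟩, hmax⟩ := hK.exists_isMaxOn hne hcont.continuousOn
      exact ⟨_, norm_charFun_lt_one_of_tendsto_zero ν hz (norm_pos_iff.1 (hδ.trans_le hξ₀)), hmax⟩
  refine ⟨max κ (1 / 2), by positivity, max_lt hκ1 (by norm_num), fun ξ hξ => ?_⟩
  by_cases hξR : ξ ∈ Metric.closedBall (0 : V) R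
  · exact (hκ ξ ⟨hξR, hξ⟩).trans (le_max_left _ _)
  · exact (hR hξR).trans (le_max_right _ _)

end CharFunBounds

section LocalLimit

lemma exists_norm_charFun_le_exp (ν : Measure ℝ) [IsProbabilityMeasure ν]
    (h_mean : ν[fun x => x] = 0) (h_var : ∫ x, x ^ 2 ∂ν = 1) :
    ∃ δ > 0, ∀ ξ, |ξ| ≤ δ → ‖charFun ν ξ‖ ≤ Real.exp (-ξ ^ 2 / 4) := by
  have htaylor := (taylor_charFun_two (P := ν) (X := fun x => x) aemeasurable_id h_mean
    (by simpa using h_var)).bound (c := 1 / 4) (by norm_num)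
  obtain ⟨ε, hε, hb⟩ := Metric.eventually_nhds_iff.1 htaylor
  refine ⟨min (ε / 2) 1, by positivity, fun ξ hξ => ?_⟩
  have herr : ‖charFun ν ξ - (1 - (ξ : ℂ) ^ 2 / 2)‖ ≤ 1 / 4 * ξ ^ 2 := by
    simpa using hb (y := ξ) (by rw [Real.dist_eq, sub_zero]; linarith [le_min_iff.1 hξ])
  have hsq : ξ ^ 2 ≤ 1 := by
    rw [sq_le_one_iff_abs_le_one]; exact hξ.trans (min_le_right _ _)
  have hmain : ‖(1 : ℂ) - (ξ : ℂ) ^ 2 / 2‖ = 1 - ξ ^ 2 / 2 := by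
    rw [show (1 : ℂ) - (ξ : ℂ) ^ 2 / 2 = ((1 - ξ ^ 2 / 2 : ℝ) : ℂ) by push_cast; ring,
      Complex.norm_real, Real.norm_of_nonneg (by linarith)]
  calc ‖charFun ν ξ‖
      ≤ ‖charFun ν ξ - (1 - (ξ : ℂ) ^ 2 / 2)‖ + ‖(1 : ℂ) - (ξ : ℂ) ^ 2 / 2‖ := by
        refine le_of_eq_of_le ?_ (norm_add_le _ _)
        rw [sub_add_cancel]
    _ ≤ -ξ ^ 2 / 4 + 1 := by rw [hmain]; linarith
    _ ≤ Real.exp (-ξ ^ 2 / 4) := Real.add_one_le_exp _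

/-- Near the origin `charFun ν` is dominated by a Gaussian, away from it by a constant `κ < 1`. -/
lemma exists_norm_charFun_inv_sqrt_mul_pow_le (ν : Measure ℝ) [IsProbabilityMeasure ν]
    (h_mean : ν[fun x => x] = 0) (h_var : ∫ x, x ^ 2 ∂ν = 1)
    (hz : Tendsto (charFun ν) (cocompact ℝ) (𝓝 0)) :
    ∃ κ, 0 ≤ κ ∧ κ < 1 ∧ ∀ p m : ℕ, 0 < m → p ≤ m → ∀ η : ℝ,
      ‖charFun ν ((√m)⁻¹ * η)‖ ^ m ≤
        Real.exp (-η ^ 2 / 4) + κ ^ (m - p) * ‖charFun ν ((√m)⁻¹ * η)‖ ^ p := by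
  obtain ⟨δ, hδ, hnear⟩ := exists_norm_charFun_le_exp ν h_mean h_var
  obtain ⟨κ, hκ0, hκ1, hfar⟩ := exists_norm_charFun_le_lt_one ν hz hδ
  refine ⟨κ, hκ0, hκ1, fun p m hm hpm η => ?_⟩
  rcases le_total |(√m)⁻¹ * η| δ with h | h
  · calc ‖charFun ν ((√m)⁻¹ * η)‖ ^ m ≤ Real.exp (-((√m)⁻¹ * η) ^ 2 / 4) ^ m := by
          gcongr; exact hnear _ h
      _ = Real.exp (-η ^ 2 / 4) := by
        rw [← Real.exp_nat_mul, mul_pow, inv_pow, Real.sq_sqrt m.cast_nonneg]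
        congr 1; field_simp
      _ ≤ _ := le_add_of_nonneg_right (by positivity)
  · calc ‖charFun ν ((√m)⁻¹ * η)‖ ^ m
        = ‖charFun ν ((√m)⁻¹ * η)‖ ^ (m - p) * ‖charFun ν ((√m)⁻¹ * η)‖ ^ p := by
          rw [← pow_add, Nat.sub_add_cancel hpm]
      _ ≤ κ ^ (m - p) * ‖charFun ν ((√m)⁻¹ * η)‖ ^ p := by gcongr; exact hfar _ h
      _ ≤ _ := le_add_of_nonneg_left (by positivity)

lemma integrable_exp_neg_sq_div_four : Integrable (fun η : ℝ => Real.exp (-η ^ 2 / 4)) := by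
  convert integrable_exp_neg_mul_sq (b := 1 / 4) (by norm_num) using 2
  ring_nf

lemma tendsto_sqrt_mul_pow_sub {κ : ℝ} (hκ0 : 0 ≤ κ) (hκ1 : κ < 1) (p : ℕ) :
    Tendsto (fun m : ℕ => √m * κ ^ (m - p)) atTop (𝓝 0) := by
  rw [← tendsto_add_atTop_iff_nat p]
  simp only [Nat.add_sub_cancel]
  have hlim : Tendsto (fun n : ℕ => (n : ℝ) * κ ^ n + (p + 1) * κ ^ n) atTop (𝓝 0) := by
    simpa using (tendsto_self_mul_const_pow_of_lt_one hκ0 hκ1).add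
      ((tendsto_pow_atTop_nhds_zero_of_lt_one hκ0 hκ1).const_mul (p + 1 : ℝ))
  refine squeeze_zero (fun n => by positivity) (fun n => ?_) hlim
  have hsqrt : √((n + p : ℕ) : ℝ) ≤ n + p + 1 :=
    Real.sqrt_le_iff.2 ⟨by positivity, by push_cast; nlinarith⟩
  calc √((n + p : ℕ) : ℝ) * κ ^ n ≤ (n + p + 1) * κ ^ n := by gcongr
    _ = _ := by ring

lemma integral_norm_charFun_inv_sqrt_mul_pow (ν : Measure ℝ) (m p : ℕ) :
    ∫ η : ℝ, ‖charFun ν ((√m)⁻¹ * η)‖ ^ p = √m * ∫ ξ, ‖charFun ν ξ‖ ^ p := by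
  rw [Measure.integral_comp_mul_left (fun ξ : ℝ => ‖charFun ν ξ‖ ^ p) (√m)⁻¹, inv_inv,
    abs_of_nonneg (Real.sqrt_nonneg _), smul_eq_mul]

lemma tendsto_integral_of_norm_le_add {α E : Type*} [MeasurableSpace α] {μ : Measure α}
    [NormedAddCommGroup E] [NormedSpace ℝ E] {F : ℕ → α → E} {f : α → E} {g : α → ℝ}
    {r : ℕ → α → ℝ} (hF : ∀ᶠ n in atTop, Integrable (F n) μ) (hf : Integrable f μ)
    (hg : Integrable g μ) (hr : ∀ᶠ n in atTop, Integrable (r n) μ)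
    (hr0 : ∀ n, 0 ≤ r n)
    (hbound : ∀ᶠ n in atTop, ∀ᵐ x ∂μ, ‖F n x‖ ≤ g x + r n x)
    (hr_lim : Tendsto (fun n => ∫ x, r n x ∂μ) atTop (𝓝 0))
    (h_lim : ∀ᵐ x ∂μ, Tendsto (fun n => F n x) atTop (𝓝 (f x))) :
    Tendsto (fun n => ∫ x, F n x ∂μ) atTop (𝓝 (∫ x, f x ∂μ)) := by
  have hexcess : Tendsto (fun n => ∫ x, max (‖F n x - f x‖ - r n x) 0 ∂μ) atTop (𝓝 0) := by
    suffices h : Tendsto (fun n => ∫ x, max (‖F n x - f x‖ - r n x) 0 ∂μ) atTop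
        (𝓝 (∫ _, 0 ∂μ)) by simpa using h
    refine tendsto_integral_filter_of_dominated_convergence (fun x => |g x| + ‖f x‖)
      ?_ ?_ (hg.abs.add hf.norm) ?_
    · filter_upwards [hF, hr] with n hFn hrn
      exact (((hFn.sub hf).norm.sub hrn).sup (integrable_zero α ℝ μ)).1
    · filter_upwards [hbound] with n hn
      filter_upwards [hn] with x hx
      rw [Real.norm_of_nonneg (le_max_right _ _)]
      refine max_le ?_ (by positivity)
      linarith [norm_sub_le (F n x) (f x), le_abs_self (g x)]
    · filter_upwards [h_lim] with x hx
      refine squeeze_zero (fun n => le_max_right _ _) (fun n => max_le ?_ (norm_nonneg _))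
        (tendsto_iff_norm_sub_tendsto_zero.1 hx)
      exact sub_le_self _ (hr0 n x)
  rw [tendsto_iff_norm_sub_tendsto_zero]
  refine squeeze_zero' (Eventually.of_forall fun n => norm_nonneg _) ?_
    (by simpa using hexcess.add hr_lim)
  filter_upwards [hF, hr] with n hFn hrn
  have hmax : Integrable (fun x => max (‖F n x - f x‖ - r n x) 0) μ :=
    ((hFn.sub hf).norm.sub hrn).sup (integrable_zero α ℝ μ)
  rw [← integral_sub hFn hf, ← integral_add hmax hrn]
  refine (norm_integral_le_integral_norm _).trans
    (integral_mono (hFn.sub hf).norm (hmax.add hrn) fun x => ?_)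
  exact sub_le_iff_le_add.1 (le_max_left _ _)

section Standardized

variable (ν : Measure ℝ) [IsProbabilityMeasure ν] (h_mean : ν[fun x => x] = 0)
  (h_var : ∫ x, x ^ 2 ∂ν = 1) (hz : Tendsto (charFun ν) (cocompact ℝ) (𝓝 0)) {p : ℕ}
  (hp : Integrable (fun ξ => ‖charFun ν ξ‖ ^ p))

include h_mean h_var hz hp

lemma exists_integral_norm_charFun_inv_sqrt_mul_pow_le :
    ∃ C, ∀ m : ℕ, 0 < m → p ≤ m → ∫ η : ℝ, ‖charFun ν ((√m)⁻¹ * η)‖ ^ m ≤ C := by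
  obtain ⟨κ, hκ0, hκ1, hbound⟩ := exists_norm_charFun_inv_sqrt_mul_pow_le ν h_mean h_var hz
  obtain ⟨B, hB⟩ := ((tendsto_sqrt_mul_pow_sub hκ0 hκ1 p).mul_const
    (∫ ξ, ‖charFun ν ξ‖ ^ p)).bddAbove_range
  refine ⟨(∫ η : ℝ, Real.exp (-η ^ 2 / 4)) + B, fun m hm hpm => ?_⟩
  have hint : Integrable (fun η : ℝ => κ ^ (m - p) * ‖charFun ν ((√m)⁻¹ * η)‖ ^ p) :=
    (hp.comp_mul_left' (by positivity)).const_mul _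
  calc ∫ η : ℝ, ‖charFun ν ((√m)⁻¹ * η)‖ ^ m
      ≤ ∫ η : ℝ, (Real.exp (-η ^ 2 / 4) + κ ^ (m - p) * ‖charFun ν ((√m)⁻¹ * η)‖ ^ p) :=
        integral_mono_of_nonneg (ae_of_all _ fun _ => by positivity)
          (integrable_exp_neg_sq_div_four.add hint) (ae_of_all _ (hbound p m hm hpm))
    _ = (∫ η : ℝ, Real.exp (-η ^ 2 / 4)) + √m * κ ^ (m - p) * ∫ ξ, ‖charFun ν ξ‖ ^ p := by
        rw [integral_add integrable_exp_neg_sq_div_four hint, integral_const_mul,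
          integral_norm_charFun_inv_sqrt_mul_pow]
        ring
    _ ≤ _ := by gcongr; exact hB ⟨m, rfl⟩

lemma tendsto_integral_charFun_inv_sqrt_mul_pow {x : ℕ → ℝ} (hx : Tendsto x atTop (𝓝 0)) :
    Tendsto (fun m : ℕ => ∫ η : ℝ,
      Complex.exp (-(x m * η : ℝ) * Complex.I) * charFun ν ((√m)⁻¹ * η) ^ m) atTop
      (𝓝 (∫ η : ℝ, Complex.exp (-η ^ 2 / 2))) := by
  obtain ⟨κ, hκ0, hκ1, hbound⟩ := exists_norm_charFun_inv_sqrt_mul_pow_le ν h_mean h_var hz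
  have hr : ∀ᶠ m : ℕ in atTop,
      Integrable (fun η : ℝ => κ ^ (m - p) * ‖charFun ν ((√m)⁻¹ * η)‖ ^ p) := by
    filter_upwards [eventually_gt_atTop 0] with m hm
    exact (hp.comp_mul_left' (by positivity)).const_mul _
  have hF : ∀ᶠ m : ℕ in atTop, ∀ η : ℝ,
      ‖Complex.exp (-(x m * η : ℝ) * Complex.I) * charFun ν ((√m)⁻¹ * η) ^ m‖ ≤
        Real.exp (-η ^ 2 / 4) + κ ^ (m - p) * ‖charFun ν ((√m)⁻¹ * η)‖ ^ p := by
    filter_upwards [eventually_gt_atTop 0, eventually_ge_atTop p] with m hm hpm η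
    rw [norm_mul, norm_exp_neg_mul_I, one_mul, norm_pow]
    exact hbound p m hm hpm η
  refine tendsto_integral_of_norm_le_add (g := fun η => Real.exp (-η ^ 2 / 4))
    (r := fun m η => κ ^ (m - p) * ‖charFun ν ((√m)⁻¹ * η)‖ ^ p) ?_ ?_
    integrable_exp_neg_sq_div_four hr (fun m η => by positivity)
    (hF.mono fun m hm => ae_of_all _ hm) ?_ (ae_of_all _ fun η => ?_)
  · filter_upwards [hr, hF] with m hrm hFm
    exact (integrable_exp_neg_sq_div_four.add hrm).mono'
      ((Continuous.aestronglyMeasurable (by fun_prop)).mul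
        ((continuous_charFun.comp (continuous_const_mul _)).pow m).aestronglyMeasurable)
      (ae_of_all _ hFm)
  · simpa [div_eq_inv_mul] using integrable_cexp_neg_mul_sq (b := 1 / 2) (by norm_num)
  · simp only [integral_const_mul, integral_norm_charFun_inv_sqrt_mul_pow]
    simpa [mul_assoc, mul_left_comm] using
      (tendsto_sqrt_mul_pow_sub hκ0 hκ1 p).mul_const (∫ ξ, ‖charFun ν ξ‖ ^ p)
  · have hclt : Tendsto (fun m : ℕ => charFun ν ((√m)⁻¹ * η) ^ m) atTop
        (𝓝 (Complex.exp (-η ^ 2 / 2))) := by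
      simpa using tendsto_charFun_inv_sqrt_mul_pow (P := ν) (X := fun x => x) aemeasurable_id h_mean
        (by simpa using h_var) η
    have hphase : Tendsto (fun m => Complex.exp (-(x m * η : ℝ) * Complex.I)) atTop (𝓝 1) := by
      have hcont : Continuous fun y : ℝ => Complex.exp (-(y * η : ℝ) * Complex.I) := by fun_prop
      simpa [Function.comp_def] using (hcont.tendsto 0).comp hx
    simpa using hphase.mul hclt

end Standardized

/-- The image of `ν` under the affine map bringing its mean to `0` and its variance to `1`
(a Dirac mass when `ν` has variance `0`). -/
def standardize (ν : Measure ℝ) : Measure ℝ :=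
  ν.map fun x => (√Var[fun x => x; ν])⁻¹ * (x - ν[fun x => x])

section Standardize

variable {ν : Measure ℝ}

instance [IsProbabilityMeasure ν] : IsProbabilityMeasure (standardize ν) :=
  Measure.isProbabilityMeasure_map (by fun_prop)

lemma integral_standardize [IsProbabilityMeasure ν] (hint : Integrable (fun x => x) ν) :
    ∫ x, x ∂standardize ν = 0 := by
  rw [standardize, integral_map (by fun_prop) (by fun_prop), integral_const_mul,
    integral_sub hint (integrable_const _), integral_const, probReal_univ, one_smul, sub_self,
    mul_zero]

lemma integral_sq_standardize (hvar : 0 < Var[fun x => x; ν]) :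
    ∫ x, x ^ 2 ∂standardize ν = 1 := by
  rw [standardize, integral_map (by fun_prop) (by fun_prop)]
  simp only [mul_pow]
  rw [integral_const_mul, ← variance_eq_integral (by fun_prop), inv_pow, Real.sq_sqrt hvar.le,
    inv_mul_cancel₀ hvar.ne']

lemma charFun_eq_charFun_standardize (hvar : 0 < Var[fun x => x; ν]) (ξ : ℝ) :
    charFun ν ξ = charFun (standardize ν) (√Var[fun x => x; ν] * ξ) *
      Complex.exp ((ν[fun x => x] * ξ : ℝ) * Complex.I) := by
  have hcomp : (fun x => (√Var[fun x => x; ν])⁻¹ * (x - ν[fun x => x])) =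
      (fun x => (√Var[fun x => x; ν])⁻¹ * x) ∘ fun x => x + -ν[fun x => x] := by
    ext x; simp [sub_eq_add_neg]
  rw [standardize, hcomp, ← Measure.map_map (by fun_prop) (by fun_prop), charFun_map_mul,
    inv_mul_cancel_left₀ (Real.sqrt_pos.2 hvar).ne', charFun_map_add_const, mul_assoc,
    ← Complex.exp_add]
  simp [mul_comm]

lemma norm_charFun_standardize (hvar : 0 < Var[fun x => x; ν]) (ξ : ℝ) :
    ‖charFun (standardize ν) ξ‖ = ‖charFun ν ((√Var[fun x => x; ν])⁻¹ * ξ)‖ := by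
  rw [charFun_eq_charFun_standardize hvar, norm_mul, Complex.norm_exp_ofReal_mul_I, mul_one,
    mul_inv_cancel_left₀ (Real.sqrt_pos.2 hvar).ne']

lemma tendsto_charFun_standardize (hvar : 0 < Var[fun x => x; ν])
    (hz : Tendsto (charFun ν) (cocompact ℝ) (𝓝 0)) :
    Tendsto (charFun (standardize ν)) (cocompact ℝ) (𝓝 0) := by
  rw [tendsto_zero_iff_norm_tendsto_zero] at hz ⊢
  simp only [norm_charFun_standardize hvar]
  exact hz.comp (Homeomorph.mulLeft₀ _
    (inv_ne_zero (Real.sqrt_pos.2 hvar).ne')).isClosedEmbedding.tendsto_cocompact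

lemma integrable_norm_charFun_standardize_pow (hvar : 0 < Var[fun x => x; ν]) {p : ℕ}
    (hp : Integrable (fun ξ => ‖charFun ν ξ‖ ^ p)) :
    Integrable (fun ξ => ‖charFun (standardize ν) ξ‖ ^ p) := by
  simp only [norm_charFun_standardize hvar]
  exact hp.comp_mul_left' (inv_ne_zero (Real.sqrt_pos.2 hvar).ne')

lemma sqrt_mul_invDensity_charFun_pow (hvar : 0 < Var[fun x => x; ν]) {m : ℕ} (hm : 0 < m)
    (u : ℝ) :
    √m * invDensity (fun ξ => charFun ν ξ ^ m) u = (2 * π * √Var[fun x => x; ν])⁻¹ *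
      (∫ η : ℝ, Complex.exp
        (-(((u - m * ν[fun x => x]) / (√Var[fun x => x; ν] * √m)) * η : ℝ) * Complex.I) *
          charFun (standardize ν) ((√m)⁻¹ * η) ^ m).re := by
  have hchar := charFun_eq_charFun_standardize hvar
  have hσ : 0 < √Var[fun x => x; ν] := Real.sqrt_pos.2 hvar
  generalize √Var[fun x => x; ν] = σ at hchar hσ ⊢
  generalize ν[fun x => x] = a at hchar ⊢
  have : 0 < √(m : ℝ) := by positivity
  have hscale := Measure.integral_comp_mul_left
    (fun η : ℝ => Complex.exp (-(((u - m * a) / (σ * √m)) * η : ℝ) * Complex.I) *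
      charFun (standardize ν) ((√m)⁻¹ * η) ^ m) (σ * √m)
  rw [abs_of_pos (by positivity)] at hscale
  have hcongr : ∫ ξ : ℝ, Complex.exp (-(u * ξ : ℝ) * Complex.I) * charFun ν ξ ^ m =
      ∫ ξ : ℝ, Complex.exp (-(((u - m * a) / (σ * √m)) * (σ * √m * ξ) : ℝ) * Complex.I) *
        charFun (standardize ν) ((√m)⁻¹ * (σ * √m * ξ)) ^ m := by
    congr 1 with ξ
    rw [hchar ξ, mul_pow, ← Complex.exp_nat_mul, mul_left_comm, mul_comm, ← Complex.exp_add,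
      show (√(m : ℝ))⁻¹ * (σ * √m * ξ) = σ * ξ by field_simp,
      show ((u - m * a) / (σ * √m)) * (σ * √m * ξ) = (u - m * a) * ξ by field_simp]
    congr 2
    push_cast
    ring
  rw [invDensity, hcongr, hscale, Complex.real_smul, Complex.re_ofReal_mul]
  generalize Complex.re _ = R
  field_simp

end Standardize

section LocalCentralLimit

variable (ν : Measure ℝ) [IsProbabilityMeasure ν] (h2 : MemLp (fun x => x) 2 ν)
  (hz : Tendsto (charFun ν) (cocompact ℝ) (𝓝 0))

include h2 hz

lemma variance_pos_of_tendsto_charFun_zero : 0 < Var[fun x => x; ν] := by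
  refine (variance_nonneg _ _).lt_of_ne' fun hvar => ?_
  have hconst : (fun x : ℝ => Complex.exp (1 * x * Complex.I)) =ᵐ[ν]
      fun _ => Complex.exp ((ν[fun x => x] : ℝ) * Complex.I) := by
    filter_upwards [ae_eq_integral_of_variance_eq_zero h2 hvar] with x hx
    rw [hx, one_mul]
  have hlt := norm_charFun_lt_one_of_tendsto_zero ν hz (ξ := 1) one_ne_zero
  rw [charFun_apply_real, Complex.ofReal_one, integral_congr_ae hconst, integral_const,
    probReal_univ, one_smul, Complex.norm_exp_ofReal_mul_I] at hlt
  exact lt_irrefl _ hlt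

variable {p : ℕ} (hp : Integrable (fun ξ => ‖charFun ν ξ‖ ^ p))

include hp

theorem tendsto_sqrt_mul_invDensity_charFun_pow (x : ℝ) :
    Tendsto (fun m : ℕ =>
      √m * invDensity (fun ξ => charFun ν ξ ^ m) (m * ν[fun x => x] + x)) atTop
      (𝓝 (√(2 * π * Var[fun x => x; ν]))⁻¹) := by
  have hvar := variance_pos_of_tendsto_charFun_zero ν h2 hz
  have hx : Tendsto (fun m : ℕ => x / (√Var[fun x => x; ν] * √(m : ℝ))) atTop (𝓝 0) :=
    tendsto_const_nhds.div_atTop ((Real.tendsto_sqrt_atTop.comp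
      tendsto_natCast_atTop_atTop).const_mul_atTop (Real.sqrt_pos.2 hvar))
  have hlim := ((Complex.continuous_re.tendsto _).comp (tendsto_integral_charFun_inv_sqrt_mul_pow
    (standardize ν) (integral_standardize (h2.integrable one_le_two))
    (integral_sq_standardize hvar) (tendsto_charFun_standardize hvar hz)
    (integrable_norm_charFun_standardize_pow hvar hp) hx)).const_mul
      (2 * π * √Var[fun x => x; ν])⁻¹
  have hgauss : (∫ η : ℝ, Complex.exp (-η ^ 2 / 2)).re = √(2 * π) := by
    have hreal (η : ℝ) : Complex.exp (-η ^ 2 / 2) = (Real.exp (-(1 / 2) * η ^ 2) : ℝ) := by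
      push_cast; ring_nf
    rw [funext hreal, integral_complex_ofReal, Complex.ofReal_re, integral_gaussian]
    congr 1; field_simp
  have hconst : (2 * π * √Var[fun x => x; ν])⁻¹ * √(2 * π) = (√(2 * π * Var[fun x => x; ν]))⁻¹ := by
    rw [Real.sqrt_mul (show 0 ≤ 2 * π by positivity)]
    nth_rw 1 [← Real.mul_self_sqrt (show 0 ≤ 2 * π by positivity)]
    field_simp
  rw [hgauss, hconst] at hlim
  refine hlim.congr' ?_
  filter_upwards [eventually_gt_atTop 0] with m hm
  rw [sqrt_mul_invDensity_charFun_pow hvar hm, add_sub_cancel_left, Function.comp_apply]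

theorem exists_sqrt_mul_abs_invDensity_charFun_pow_le :
    ∃ C, ∀ m : ℕ, 0 < m → p ≤ m → ∀ u,
      √m * |invDensity (fun ξ => charFun ν ξ ^ m) u| ≤ C := by
  have hvar := variance_pos_of_tendsto_charFun_zero ν h2 hz
  obtain ⟨C, hC⟩ := exists_integral_norm_charFun_inv_sqrt_mul_pow_le (standardize ν)
    (integral_standardize (h2.integrable one_le_two)) (integral_sq_standardize hvar)
    (tendsto_charFun_standardize hvar hz) (integrable_norm_charFun_standardize_pow hvar hp)
  refine ⟨(2 * π * √Var[fun x => x; ν])⁻¹ * C, fun m hm hpm u => ?_⟩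
  rw [← abs_of_nonneg (Real.sqrt_nonneg (m : ℝ)), ← abs_mul,
    sqrt_mul_invDensity_charFun_pow hvar hm, abs_mul, abs_of_nonneg (by positivity)]
  gcongr
  refine (Complex.abs_re_le_norm _).trans ((norm_integral_le_integral_norm _).trans ?_)
  simpa only [norm_mul, norm_exp_neg_mul_I, one_mul, norm_pow] using hC m hm hpm

end LocalCentralLimit

end LocalLimit

section SquareLaw

lemma lintegral_Ioi_eq_lintegral_sqrt (G : ℝ → ℝ≥0∞) :
    ∫⁻ z in Set.Ioi 0, G z = ∫⁻ w in Set.Ioi 0, ENNReal.ofReal (1 / (2 * √w)) * G √w := by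
  have himage : Real.sqrt '' Set.Ioi 0 = Set.Ioi 0 := by
    ext z
    refine ⟨?_, fun hz => ⟨z ^ 2, pow_pos (Set.mem_Ioi.1 hz) 2, Real.sqrt_sq (le_of_lt hz)⟩⟩
    rintro ⟨w, hw, rfl⟩
    exact Real.sqrt_pos.2 hw
  have hsubst := lintegral_image_eq_lintegral_abs_deriv_mul measurableSet_Ioi
    (fun w hw => (Real.hasDerivAt_sqrt (ne_of_gt hw)).hasDerivWithinAt)
    (fun x hx y hy h => (Real.sqrt_inj (le_of_lt hx) (le_of_lt hy)).1 h) G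
  rw [himage] at hsubst
  rw [hsubst]
  refine setLIntegral_congr_fun measurableSet_Ioi fun w _ => ?_
  rw [abs_of_nonneg (by positivity)]

lemma lintegral_eq_lintegral_sqrt {G : ℝ → ℝ≥0∞} (hG : Measurable G) :
    ∫⁻ z, G z = ∫⁻ w in Set.Ioi 0, ENNReal.ofReal (1 / (2 * √w)) * (G √w + G (-√w)) := by
  have hneg : ∫⁻ z in Set.Iio 0, G z = ∫⁻ z in Set.Ioi 0, G (-z) := by
    rw [← (Measure.measurePreserving_neg volume).setLIntegral_comp_preimage_emb
      (Homeomorph.neg ℝ).measurableEmbedding G]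
    simp
  simp only [mul_add]
  rw [lintegral_add_left (by fun_prop), ← lintegral_Ioi_eq_lintegral_sqrt,
    ← lintegral_Ioi_eq_lintegral_sqrt fun z => G (-z), ← hneg,
    ← lintegral_add_compl _ (measurableSet_Ioi (a := (0 : ℝ))), Set.compl_Ioi,
    setLIntegral_congr Iio_ae_eq_Iic.symm]

/-- The density of `v ^ 2` when `v` has density `g`. -/
def sqDensity (g : ℝ → ℝ≥0∞) : ℝ → ℝ≥0∞ :=
  (Set.Ioi 0).indicator fun w => ENNReal.ofReal (1 / (2 * √w)) * (g √w + g (-√w))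

@[fun_prop]
lemma measurable_sqDensity {g : ℝ → ℝ≥0∞} (hg : Measurable g) : Measurable (sqDensity g) :=
  Measurable.indicator (by fun_prop) measurableSet_Ioi

lemma lintegral_comp_sq_mul {g h : ℝ → ℝ≥0∞} (hg : Measurable g) (hh : Measurable h) :
    ∫⁻ v, h (v ^ 2) * g v = ∫⁻ w, h w * sqDensity g w := by
  rw [lintegral_eq_lintegral_sqrt (by fun_prop), ← lintegral_indicator measurableSet_Ioi]
  congr 1 with w
  unfold sqDensity
  by_cases hw : w ∈ Set.Ioi (0 : ℝ)
  · rw [Set.indicator_of_mem hw, Set.indicator_of_mem hw, neg_sq, Real.sq_sqrt (le_of_lt hw)]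
    ring
  · rw [Set.indicator_of_notMem hw, Set.indicator_of_notMem hw, mul_zero]

lemma map_sq_withDensity {g : ℝ → ℝ≥0∞} (hg : Measurable g) :
    (volume.withDensity g).map (fun v => v ^ 2) = volume.withDensity (sqDensity g) := by
  refine Measure.ext_of_lintegral _ fun h hh => ?_
  rw [lintegral_map hh (by fun_prop), lintegral_withDensity_eq_lintegral_mul _ hg (by fun_prop),
    lintegral_withDensity_eq_lintegral_mul _ (measurable_sqDensity hg) hh]
  simp only [Pi.mul_apply, mul_comm (g _), mul_comm (sqDensity g _)]
  exact lintegral_comp_sq_mul hg hh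

lemma lintegral_Ioi_ofReal_mul_comp_sq {h : ℝ → ℝ≥0∞} (hh : Measurable h) :
    ∫⁻ x in Set.Ioi 0, ENNReal.ofReal x * h (x ^ 2) =
      ENNReal.ofReal (1 / 2) * ∫⁻ w in Set.Ioi 0, h w := by
  rw [lintegral_Ioi_eq_lintegral_sqrt, ← lintegral_const_mul _ hh]
  refine setLIntegral_congr_fun measurableSet_Ioi fun w hw => ?_
  have : 0 < √w := Real.sqrt_pos.2 hw
  rw [Real.sq_sqrt (le_of_lt hw), ← mul_assoc, ← ENNReal.ofReal_mul (by positivity)]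
  congr 2
  field_simp

lemma lintegral_comp_sq_add_sq {h : ℝ → ℝ≥0∞} (hh : Measurable h) :
    ∫⁻ p : ℝ × ℝ, h (p.1 ^ 2 + p.2 ^ 2) = ENNReal.ofReal π * ∫⁻ w in Set.Ioi 0, h w := by
  have hpolar (r θ : ℝ) : (polarCoord.symm (r, θ)).1 ^ 2 + (polarCoord.symm (r, θ)).2 ^ 2 =
      r ^ 2 := by
    rw [polarCoord_symm_apply, mul_pow, mul_pow, ← mul_add, Real.cos_sq_add_sin_sq, mul_one]
  rw [← lintegral_comp_polarCoord_symm, polarCoord_target, Measure.volume_eq_prod,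
    ← Measure.prod_restrict, lintegral_prod _ (by fun_prop)]
  simp only [hpolar, smul_eq_mul, lintegral_const, Measure.restrict_apply MeasurableSet.univ,
    Set.univ_inter, Real.volume_Ioo]
  rw [lintegral_mul_const _ (by fun_prop), lintegral_Ioi_ofReal_mul_comp_sq hh, mul_right_comm,
    ← ENNReal.ofReal_mul (by norm_num)]
  congr 2
  ring

lemma lintegral_le_mul_of_le_smul {α : Type*} {_ : MeasurableSpace α} {μ ν : Measure α}
    {K : ℝ≥0∞} (h : μ ≤ K • ν) (G : α → ℝ≥0∞) : ∫⁻ x, G x ∂μ ≤ K * ∫⁻ x, G x ∂ν :=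
  (lintegral_mono' h le_rfl).trans_eq (lintegral_smul_measure K G)

/-- The law of `v ^ 2` under `μ`. -/
def sqLaw (μ : Measure ℝ) : Measure ℝ :=
  μ.map fun v => v ^ 2

instance (μ : Measure ℝ) [IsProbabilityMeasure μ] : IsProbabilityMeasure (sqLaw μ) :=
  Measure.isProbabilityMeasure_map (by fun_prop)

instance (μ : Measure ℝ) [SFinite μ] : SFinite (sqLaw μ) :=
  inferInstanceAs (SFinite (μ.map _))

lemma sqLaw_conv_sqLaw_le {μ : Measure ℝ} [SFinite μ] {M : ℝ≥0∞} (hμ : μ ≤ M • volume) :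
    sqLaw μ ∗ sqLaw μ ≤ (M * M * ENNReal.ofReal π) • volume := by
  refine Measure.le_iff.2 fun s hs => ?_
  have hind : Measurable (s.indicator (1 : ℝ → ℝ≥0∞)) := measurable_one.indicator hs
  have hinner (x : ℝ) : ∫⁻ y, s.indicator 1 (x ^ 2 + y) ∂sqLaw μ =
      ∫⁻ y, s.indicator 1 (x ^ 2 + y ^ 2) ∂μ := lintegral_map (by fun_prop) (by fun_prop)
  calc (sqLaw μ ∗ sqLaw μ) s
      = ∫⁻ x, ∫⁻ y, s.indicator 1 (x + y) ∂sqLaw μ ∂sqLaw μ := by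
        rw [sqLaw, ← lintegral_indicator_one hs, Measure.lintegral_conv hind]
    _ = ∫⁻ x, ∫⁻ y, s.indicator 1 (x ^ 2 + y ^ 2) ∂μ ∂μ := by
        simp only [← hinner]
        exact lintegral_map (Measurable.lintegral_prod_right (by fun_prop)) (by fun_prop)
    _ ≤ M * ∫⁻ x, M * ∫⁻ y, s.indicator 1 (x ^ 2 + y ^ 2) :=
        (lintegral_mono fun x => lintegral_le_mul_of_le_smul hμ _).trans
          (lintegral_le_mul_of_le_smul hμ _)
    _ = M * M * ∫⁻ p : ℝ × ℝ, s.indicator 1 (p.1 ^ 2 + p.2 ^ 2) := by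
        rw [lintegral_const_mul _ (Measurable.lintegral_prod_right (by fun_prop)), ← mul_assoc,
          Measure.volume_eq_prod, lintegral_prod _ (by fun_prop)]
    _ ≤ M * M * (ENNReal.ofReal π * volume s) := by
        rw [lintegral_comp_sq_add_sq hind, ← lintegral_indicator_one hs]
        gcongr
        exact Measure.restrict_le_self
    _ = ((M * M * ENNReal.ofReal π) • volume) s := by
        rw [Measure.smul_apply, smul_eq_mul, mul_assoc (M * M)]

lemma integrable_norm_charFun_sqLaw_pow_four {μ : Measure ℝ} [IsProbabilityMeasure μ] {M : ℝ≥0∞}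
    (hM : M ≠ ∞) (hμ : μ ≤ M • volume) :
    Integrable fun ξ => ‖charFun (sqLaw μ) ξ‖ ^ 4 :=
  integrable_norm_charFun_pow_four_of_conv_le_smul _
    (ENNReal.mul_ne_top (ENNReal.mul_ne_top hM hM) ENNReal.ofReal_ne_top) (sqLaw_conv_sqLaw_le hμ)

end SquareLaw

section SumSqLaw

/-- The law of `∑ i, (y i) ^ 2` under `μ^{⊗m}`. -/
def sumSqLaw (μ : Measure ℝ) (m : ℕ) : Measure ℝ :=
  (tensorPower μ m).map fun y => ∑ i, y i ^ 2

@[fun_prop]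
lemma measurable_sum_sq (m : ℕ) : Measurable fun y : Fin m → ℝ => ∑ i, y i ^ 2 :=
  (continuous_finsetSum _ fun i _ => (continuous_apply i).pow 2).measurable

variable (μ : Measure ℝ)

instance [IsProbabilityMeasure μ] (m : ℕ) : IsProbabilityMeasure (tensorPower μ m) := by
  unfold tensorPower; infer_instance

instance [IsProbabilityMeasure μ] (m : ℕ) : IsProbabilityMeasure (sumSqLaw μ m) :=
  Measure.isProbabilityMeasure_map (measurable_sum_sq m).aemeasurable

lemma charFun_sumSqLaw [SigmaFinite μ] (m : ℕ) (ξ : ℝ) :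
    charFun (sumSqLaw μ m) ξ = charFun (sqLaw μ) ξ ^ m := by
  have hprod := integral_fintype_prod_eq_pow (ι := Fin m) (μ := μ)
    (fun v : ℝ => Complex.exp (ξ * ((v ^ 2 : ℝ) : ℂ) * Complex.I))
  rw [Fintype.card_fin] at hprod
  rw [charFun_apply_real, charFun_apply_real, sumSqLaw, sqLaw, integral_map
    (measurable_sum_sq m).aemeasurable (Continuous.aestronglyMeasurable (by fun_prop)),
    integral_map (by fun_prop) (Continuous.aestronglyMeasurable (by fun_prop)), ← hprod]
  congr 1 with y
  rw [← Complex.exp_sum, ← Finset.sum_mul, ← Finset.mul_sum, Complex.ofReal_sum]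

variable [IsProbabilityMeasure μ]

lemma sumSqLaw_succ (m : ℕ) : sumSqLaw μ (m + 1) = sumSqLaw μ m ∗ sqLaw μ := by
  refine Measure.ext_of_charFun (funext fun ξ => ?_)
  rw [charFun_conv, charFun_sumSqLaw, charFun_sumSqLaw, pow_succ]

lemma sumSqLaw_eq_withDensity_invDensity (hac : sqLaw μ ≪ volume) {m : ℕ} (hm : m ≠ 0)
    (hint : Integrable fun ξ => charFun (sqLaw μ) ξ ^ m) :
    sumSqLaw μ m = volume.withDensity fun u =>
      ENNReal.ofReal (invDensity (fun ξ => charFun (sqLaw μ) ξ ^ m) u) := by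
  have hchar : charFun (sumSqLaw μ m) = fun ξ => charFun (sqLaw μ) ξ ^ m :=
    funext (charFun_sumSqLaw μ m)
  obtain ⟨j, rfl⟩ := Nat.exists_eq_succ_of_ne_zero hm
  have hac' : sumSqLaw μ (j + 1) ≪ volume := by
    rw [sumSqLaw_succ]
    exact Measure.conv_absolutelyContinuous hac
  rw [← hchar] at hint ⊢
  exact eq_withDensity_invDensity _ hac' hint

end SumSqLaw

lemma integrable_charFun_pow_of_le {ν : Measure ℝ} [IsProbabilityMeasure ν] {p m : ℕ}
    (hp : Integrable fun ξ => ‖charFun ν ξ‖ ^ p) (hpm : p ≤ m) :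
    Integrable fun ξ => charFun ν ξ ^ m := by
  refine hp.mono' (continuous_charFun.pow m).aestronglyMeasurable (ae_of_all _ fun ξ => ?_)
  rw [norm_pow]
  exact pow_le_pow_of_le_one (norm_nonneg _) (norm_charFun_le_one _) hpm

/-- A bounded measurable probability density on `ℝ` with unit second moment and finite fourth
moment. -/
structure IsKacDensity (f : ℝ → ℝ) : Prop where
  measurable : Measurable f
  nonneg : ∀ v, 0 ≤ f v
  bdd : ∃ M, ∀ v, f v ≤ M
  one : ∫ v, f v = 1
  two : ∫ v, f v * v ^ 2 = 1
  four : Integrable fun v => f v * v ^ 4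

namespace IsKacDensity

variable {f : ℝ → ℝ} (hf : IsKacDensity f)

include hf

lemma integrable : Integrable f :=
  Integrable.of_integral_ne_zero (hf.one ▸ one_ne_zero)

lemma integrable_two : Integrable fun v => f v * v ^ 2 :=
  Integrable.of_integral_ne_zero (hf.two ▸ one_ne_zero)

lemma measurable_ofReal : Measurable fun v => ENNReal.ofReal (f v) :=
  hf.measurable.ennreal_ofReal

lemma isProbabilityMeasure : IsProbabilityMeasure (density f) := by
  constructor
  rw [density, withDensity_apply _ MeasurableSet.univ, setLIntegral_univ,
    ← ofReal_integral_eq_lintegral_ofReal hf.integrable (ae_of_all _ hf.nonneg), hf.one,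
    ENNReal.ofReal_one]

lemma integral_density (h : ℝ → ℝ) : ∫ v, h v ∂density f = ∫ v, f v * h v := by
  rw [density, integral_withDensity_eq_integral_toReal_smul hf.measurable_ofReal
    (ae_of_all _ fun _ => ENNReal.ofReal_lt_top)]
  simp [ENNReal.toReal_ofReal (hf.nonneg _)]

lemma integrable_density_iff {h : ℝ → ℝ} :
    Integrable h (density f) ↔ Integrable fun v => f v * h v := by
  rw [density, integrable_withDensity_iff_integrable_smul₀' hf.measurable_ofReal.aemeasurable
    (ae_of_all _ fun _ => ENNReal.ofReal_lt_top)]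
  simp [ENNReal.toReal_ofReal (hf.nonneg _)]

lemma exists_density_le_smul : ∃ M : ℝ≥0∞, M ≠ ∞ ∧ density f ≤ M • volume := by
  obtain ⟨M, hM⟩ := hf.bdd
  refine ⟨ENNReal.ofReal M, ENNReal.ofReal_ne_top, ?_⟩
  rw [← withDensity_const]
  exact withDensity_mono (ae_of_all _ fun v => ENNReal.ofReal_le_ofReal (hM v))

lemma sqLaw_absolutelyContinuous : sqLaw (density f) ≪ volume := by
  rw [sqLaw, density, map_sq_withDensity hf.measurable_ofReal]
  exact withDensity_absolutelyContinuous _ _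

lemma tendsto_charFun_sqLaw : Tendsto (charFun (sqLaw (density f))) (cocompact ℝ) (𝓝 0) :=
  have := hf.isProbabilityMeasure
  tendsto_charFun_cocompact _ hf.sqLaw_absolutelyContinuous

lemma integrable_norm_charFun_sqLaw_pow_four :
    Integrable fun ξ => ‖charFun (sqLaw (density f)) ξ‖ ^ 4 := by
  have := hf.isProbabilityMeasure
  obtain ⟨M, hM, hle⟩ := hf.exists_density_le_smul
  exact KacChaos.integrable_norm_charFun_sqLaw_pow_four hM hle

lemma integrable_charFun_sqLaw_pow {m : ℕ} (hm : 4 ≤ m) :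
    Integrable fun ξ => charFun (sqLaw (density f)) ξ ^ m :=
  have := hf.isProbabilityMeasure
  integrable_charFun_pow_of_le hf.integrable_norm_charFun_sqLaw_pow_four hm

lemma memLp_two_sqLaw : MemLp (fun x => x) 2 (sqLaw (density f)) := by
  rw [sqLaw, memLp_map_measure_iff (by fun_prop) (by fun_prop), Function.comp_def,
    memLp_two_iff_integrable_sq (by fun_prop), hf.integrable_density_iff]
  simpa only [← pow_mul] using hf.four

lemma integral_sqLaw : ∫ x, x ∂sqLaw (density f) = 1 := by
  rw [sqLaw, integral_map (by fun_prop) (by fun_prop), hf.integral_density, hf.two]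

lemma variance_sqLaw_pos : 0 < Var[fun x => x; sqLaw (density f)] :=
  have := hf.isProbabilityMeasure
  variance_pos_of_tendsto_charFun_zero _ hf.memLp_two_sqLaw hf.tendsto_charFun_sqLaw

end IsKacDensity

section SumSqDensity

/-- The density at `r` of the sum of `m + 1` independent squares, written as a convolution so that
it is defined pointwise for every `m`. -/
def sumSqDensity (f : ℝ → ℝ) (m : ℕ) (r : ℝ) : ℝ≥0∞ :=
  ∫⁻ y, sqDensity (fun v => ENNReal.ofReal (f v)) (r - ∑ i, y i ^ 2) ∂tensorPower (density f) m

variable {f : ℝ → ℝ} (hf : IsKacDensity f)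

include hf

lemma measurable_sumSqDensity (m : ℕ) : Measurable (sumSqDensity f m) := by
  have := hf.isProbabilityMeasure
  exact Measurable.lintegral_prod_right' (f := fun p : ℝ × (Fin m → ℝ) =>
    sqDensity (fun v => ENNReal.ofReal (f v)) (p.1 - ∑ i, p.2 i ^ 2))
    ((measurable_sqDensity hf.measurable_ofReal).comp
      (measurable_fst.sub ((measurable_sum_sq m).comp measurable_snd)))

lemma sumSqDensity_eq_lintegral_invDensity {m : ℕ} (hm : 4 ≤ m) (r : ℝ) :
    sumSqDensity f m r = ∫⁻ v, ENNReal.ofReal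
      (invDensity (fun ξ => charFun (sqLaw (density f)) ξ ^ m) (r - v ^ 2)) ∂density f := by
  have := hf.isProbabilityMeasure
  have hlaw := sumSqLaw_eq_withDensity_invDensity (density f) hf.sqLaw_absolutelyContinuous
    (by lia) (hf.integrable_charFun_sqLaw_pow hm)
  have hcont := continuous_invDensity (hf.integrable_charFun_sqLaw_pow hm)
  generalize invDensity (fun ξ => charFun (sqLaw (density f)) ξ ^ m) = s at hlaw hcont ⊢
  have hs : Measurable fun u => ENNReal.ofReal (s u) := hcont.measurable.ennreal_ofReal
  have hg := hf.measurable_ofReal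
  calc sumSqDensity f m r
      = ∫⁻ u, sqDensity (fun v => ENNReal.ofReal (f v)) (r - u) ∂sumSqLaw (density f) m := by
        rw [sumSqLaw, lintegral_map (by fun_prop) (measurable_sum_sq m), sumSqDensity]
    _ = ∫⁻ u, ENNReal.ofReal (s u) * sqDensity (fun v => ENNReal.ofReal (f v)) (r - u) := by
        rw [hlaw]
        exact lintegral_withDensity_eq_lintegral_mul _ hs (by fun_prop)
    _ = ∫⁻ w, ENNReal.ofReal (s (r - w)) * sqDensity (fun v => ENNReal.ofReal (f v)) w := by
        rw [← lintegral_sub_left_eq_self _ r]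
        simp only [sub_sub_cancel]
    _ = ∫⁻ v, ENNReal.ofReal (s (r - v ^ 2)) * ENNReal.ofReal (f v) :=
        (lintegral_comp_sq_mul hg (h := fun w => ENNReal.ofReal (s (r - w))) (by fun_prop)).symm
    _ = ∫⁻ v, ENNReal.ofReal (s (r - v ^ 2)) ∂density f := by
        rw [density, lintegral_withDensity_eq_lintegral_mul _ hg (by fun_prop)]
        simp only [Pi.mul_apply, mul_comm]

lemma toReal_sumSqDensity {m : ℕ} (hm : 4 ≤ m) (r : ℝ) :
    (sumSqDensity f m r).toReal = ∫ v, max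
      (invDensity (fun ξ => charFun (sqLaw (density f)) ξ ^ m) (r - v ^ 2)) 0 ∂density f := by
  have hcont := continuous_invDensity (hf.integrable_charFun_sqLaw_pow hm)
  rw [sumSqDensity_eq_lintegral_invDensity hf hm, integral_eq_lintegral_of_nonneg_ae
    (f := fun v => max (invDensity _ (r - v ^ 2)) 0) (ae_of_all _ fun _ => le_max_right _ _)
    (Continuous.aestronglyMeasurable (by fun_prop))]
  simp

lemma exists_sqrt_mul_max_invDensity_le : ∃ C, ∀ m : ℕ, 4 ≤ m → ∀ u,
    √m * max (invDensity (fun ξ => charFun (sqLaw (density f)) ξ ^ m) u) 0 ≤ C := by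
  have := hf.isProbabilityMeasure
  obtain ⟨C, hC⟩ := exists_sqrt_mul_abs_invDensity_charFun_pow_le (sqLaw (density f))
    hf.memLp_two_sqLaw hf.tendsto_charFun_sqLaw hf.integrable_norm_charFun_sqLaw_pow_four
  refine ⟨C, fun m hm u => le_trans ?_ (hC m (by lia) hm u)⟩
  gcongr
  exact max_le (le_abs_self _) (abs_nonneg _)

theorem tendsto_sqrt_mul_sumSqDensity (x : ℝ) :
    Tendsto (fun m : ℕ => √m * (sumSqDensity f m (m + x)).toReal) atTop
      (𝓝 (√(2 * π * Var[fun x => x; sqLaw (density f)]))⁻¹) := by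
  have := hf.isProbabilityMeasure
  obtain ⟨C, hC⟩ := exists_sqrt_mul_max_invDensity_le hf
  have hlim (y : ℝ) := tendsto_sqrt_mul_invDensity_charFun_pow (sqLaw (density f))
    hf.memLp_two_sqLaw hf.tendsto_charFun_sqLaw hf.integrable_norm_charFun_sqLaw_pow_four y
  simp only [hf.integral_sqLaw, mul_one] at hlim
  generalize hL : (√(2 * π * Var[fun x => x; sqLaw (density f)]))⁻¹ = L at hlim ⊢
  have hL0 : 0 ≤ L := hL ▸ by positivity
  have hdct : Tendsto (fun m : ℕ => ∫ v, √m * max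
      (invDensity (fun ξ => charFun (sqLaw (density f)) ξ ^ m) (m + x - v ^ 2)) 0 ∂density f)
      atTop (𝓝 (∫ _, L ∂density f)) := by
    refine tendsto_integral_filter_of_dominated_convergence (fun _ => C) ?_ ?_
      (integrable_const _) (ae_of_all _ fun v => ?_)
    · filter_upwards [eventually_ge_atTop 4] with m hm
      have := continuous_invDensity (hf.integrable_charFun_sqLaw_pow hm)
      exact Continuous.aestronglyMeasurable (by fun_prop)
    · filter_upwards [eventually_ge_atTop 4] with m hm
      refine ae_of_all _ fun v => ?_
      rw [Real.norm_of_nonneg (by positivity)]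
      exact hC m hm _
    · have hmax := (hlim (x - v ^ 2)).max (tendsto_const_nhds (x := (0 : ℝ)))
      rw [max_eq_left hL0] at hmax
      refine hmax.congr fun m => ?_
      rw [mul_max_of_nonneg _ _ (Real.sqrt_nonneg _), mul_zero, add_sub_assoc]
  rw [integral_const, probReal_univ, one_smul] at hdct
  refine hdct.congr' ?_
  filter_upwards [eventually_ge_atTop 4] with m hm
  rw [integral_const_mul, toReal_sumSqDensity hf hm]

theorem exists_sqrt_mul_sumSqDensity_le : ∃ C : ℝ, ∀ m : ℕ, 4 ≤ m → ∀ r,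
    ENNReal.ofReal √m * sumSqDensity f m r ≤ ENNReal.ofReal C := by
  have := hf.isProbabilityMeasure
  obtain ⟨C, hC⟩ := exists_sqrt_mul_max_invDensity_le hf
  refine ⟨C, fun m hm r => ?_⟩
  rw [sumSqDensity_eq_lintegral_invDensity hf hm, ← lintegral_const_mul' _ _ ENNReal.ofReal_ne_top]
  calc _ ≤ ∫⁻ _, ENNReal.ofReal C ∂density f := by
        refine lintegral_mono fun v => ?_
        rw [← ENNReal.ofReal_mul (Real.sqrt_nonneg _)]
        refine ENNReal.ofReal_le_ofReal (le_trans ?_ (hC m hm (r - v ^ 2)))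
        gcongr
        exact le_max_left _ _
    _ = ENNReal.ofReal C := by simp

end SumSqDensity

section UniformMeasure

lemma measurable_dilate (N : ℕ) : Measurable (dilate N) :=
  Measurable.subtype_mk (by fun_prop)

lemma isProbabilityMeasure_unif {N : ℕ} (hN : N ≠ 0) : IsProbabilityMeasure (unif N) := by
  have : NeZero N := ⟨hN⟩
  have hne : surfaceMeasure N Set.univ ≠ 0 :=
    Measure.measure_univ_eq_zero.not.2 (Measure.toSphere_ne_zero _)
  have hfin : surfaceMeasure N Set.univ ≠ ∞ := by
    unfold surfaceMeasure
    exact measure_ne_top _ _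
  have : IsProbabilityMeasure ((surfaceMeasure N Set.univ)⁻¹ • surfaceMeasure N) :=
    ⟨by rw [Measure.smul_apply, smul_eq_mul, ENNReal.inv_mul_cancel hne hfin]⟩
  exact Measure.isProbabilityMeasure_map (measurable_dilate N).aemeasurable

lemma map_val_toSphere {E : Type*} [NormedAddCommGroup E] [NormedSpace ℝ E] [MeasurableSpace E]
    [BorelSpace E] [SecondCountableTopology E] (μ : Measure E) :
    μ.toSphere.map Subtype.val = (Module.finrank ℝ E : ℝ≥0∞) •
      (μ.restrict (Metric.ball 0 1 \ {0})).map fun x => ‖x‖⁻¹ • x := by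
  ext s hs
  have hproj : Measurable fun x : E => ‖x‖⁻¹ • x := by fun_prop
  rw [Measure.map_apply measurable_subtype_coe hs,
    Measure.toSphere_apply' _ (measurable_subtype_coe hs), Measure.smul_apply, smul_eq_mul,
    Measure.map_apply hproj hs, Measure.restrict_apply (hproj hs)]
  congr 2
  ext x
  rw [Set.mem_smul]
  constructor
  · rintro ⟨r, hr, _, ⟨y, hy, rfl⟩, rfl⟩
    have hnorm : ‖r • (y : E)‖ = r := by
      rw [norm_smul, norm_eq_of_mem_sphere y, mul_one, Real.norm_of_nonneg hr.1.le]
    refine ⟨?_, mem_ball_zero_iff.2 (hnorm.trans_lt hr.2), ?_⟩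
    · rwa [Set.mem_preimage, hnorm, smul_smul, inv_mul_cancel₀ hr.1.ne', one_smul]
    · rw [Set.mem_singleton_iff, ← norm_eq_zero, hnorm]
      exact hr.1.ne'
  · rintro ⟨hx, hb, h0⟩
    have hpos : 0 < ‖x‖ := norm_pos_iff.2 h0
    refine ⟨‖x‖, ⟨hpos, by simpa using hb⟩, ‖x‖⁻¹ • x, ⟨⟨‖x‖⁻¹ • x, ?_⟩, hx, rfl⟩, ?_⟩
    · rw [mem_sphere_zero_iff_norm, norm_smul, norm_inv, norm_norm, inv_mul_cancel₀ hpos.ne']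
    · rw [smul_smul, mul_inv_cancel₀ hpos.ne', one_smul]

lemma lintegral_unif_eq_setLIntegral_ball {N : ℕ} {F : EuclideanSpace ℝ (Fin N) → ℝ≥0∞}
    (hF : Measurable F) :
    ∫⁻ v : KacSphere N, F v ∂unif N = (surfaceMeasure N Set.univ)⁻¹ *
      (N * ∫⁻ x in Metric.ball 0 1 \ {0}, F ((√N / ‖x‖) • x)) := by
  have hsurface : ∫⁻ x, F (dilate N x) ∂surfaceMeasure N =
      ∫⁻ x, F (√N • x) ∂(surfaceMeasure N).map Subtype.val :=
    (lintegral_map (f := fun x => F (√N • x)) (by fun_prop) measurable_subtype_coe).symm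
  rw [unif, lintegral_map (by fun_prop) (measurable_dilate N), lintegral_smul_measure, smul_eq_mul,
    hsurface, surfaceMeasure, map_val_toSphere, lintegral_smul_measure, smul_eq_mul,
    lintegral_map (by fun_prop) (by fun_prop), finrank_euclideanSpace_fin]
  simp only [smul_smul, div_eq_mul_inv]

lemma lintegral_unif_comp_linearIsometryEquiv {N : ℕ} {F : EuclideanSpace ℝ (Fin N) → ℝ≥0∞}
    (hF : Measurable F) (L : EuclideanSpace ℝ (Fin N) ≃ₗᵢ[ℝ] EuclideanSpace ℝ (Fin N)) :
    ∫⁻ v : KacSphere N, F (L v) ∂unif N = ∫⁻ v : KacSphere N, F v ∂unif N := by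
  have hball : L ⁻¹' (Metric.ball 0 1 \ {0}) = Metric.ball 0 1 \ {0} := by
    ext x
    simp
  rw [lintegral_unif_eq_setLIntegral_ball (F := fun x => F (L x)) (hF.comp L.continuous.measurable),
    lintegral_unif_eq_setLIntegral_ball hF,
    ← L.measurePreserving.setLIntegral_comp_preimage (f := fun x => F ((√N / ‖x‖) • x))
      (measurableSet_ball.diff (measurableSet_singleton 0)) (by fun_prop), hball]
  simp only [map_smul, LinearIsometryEquiv.norm_map]

lemma lintegral_unif_comp_perm {N : ℕ} (τ : Equiv.Perm (Fin N)) {F : (Fin N → ℝ) → ℝ≥0∞}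
    (hF : Measurable F) :
    ∫⁻ v : KacSphere N, F (fun i => v.1 (τ i)) ∂unif N =
      ∫⁻ v : KacSphere N, F (fun i => v.1 i) ∂unif N :=
  lintegral_unif_comp_linearIsometryEquiv (F := fun v => F fun i => v i) (by fun_prop)
    (LinearIsometryEquiv.piLpCongrLeft 2 ℝ ℝ τ.symm)

end UniformMeasure

section ProductIntegrals

instance (f : ℝ → ℝ) : SigmaFinite (density f) :=
  inferInstanceAs (SigmaFinite (volume.withDensity _))

@[fun_prop]
lemma measurable_finSnoc {n : ℕ} :
    Measurable fun p : (Fin n → ℝ) × ℝ => (Fin.snoc p.1 p.2 : Fin (n + 1) → ℝ) :=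
  (continuous_fst.finSnoc continuous_snd).measurable

lemma lintegral_tensorPower_succ (μ : Measure ℝ) [SigmaFinite μ] {n : ℕ}
    {K : (Fin (n + 1) → ℝ) → ℝ≥0∞} (hK : Measurable K) :
    ∫⁻ x, K x ∂tensorPower μ (n + 1) =
      ∫⁻ y, ∫⁻ z, K (Fin.snoc y z) ∂μ ∂tensorPower μ n := by
  have h := (measurePreserving_piFinSuccAbove (fun _ : Fin (n + 1) => μ) (Fin.last n)).symm
  rw [tensorPower, ← h.lintegral_comp hK,
    lintegral_prod_symm _ (by fun_prop)]
  refine lintegral_congr fun y => lintegral_congr fun z => ?_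
  congr 1
  exact Fin.insertNth_last (α := fun _ => ℝ) z y

lemma lintegral_tensorPower_add (μ : Measure ℝ) [SigmaFinite μ] {k m : ℕ}
    {K : (Fin (k + m) → ℝ) → ℝ≥0∞} (hK : Measurable K) :
    ∫⁻ x, K x ∂tensorPower μ (k + m) =
      ∫⁻ x, ∫⁻ y, K (Fin.append x y) ∂tensorPower μ m ∂tensorPower μ k := by
  have h := (measurePreserving_piCongrLeft (α := fun _ : Fin (k + m) => ℝ) (fun _ => μ)
    finSumFinEquiv).comp (measurePreserving_sumPiEquivProdPi_symm (fun _ : Fin k ⊕ Fin m => μ))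
  rw [tensorPower, ← h.lintegral_comp hK,
    lintegral_prod _ (by exact (hK.comp h.measurable).aemeasurable)]
  refine lintegral_congr fun x => lintegral_congr fun y => ?_
  congr 1
  ext i
  refine Fin.addCases (fun j => ?_) (fun j => ?_) i
  · rw [Fin.append_left, Function.comp_apply, MeasurableEquiv.coe_piCongrLeft,
      ← finSumFinEquiv_apply_left, Equiv.piCongrLeft_apply_apply]
    rfl
  · rw [Fin.append_right, Function.comp_apply, MeasurableEquiv.coe_piCongrLeft,
      ← finSumFinEquiv_apply_right, Equiv.piCongrLeft_apply_apply]
    rfl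

lemma lintegral_tensorPower_density {f : ℝ → ℝ} (hf : Measurable f) {n : ℕ}
    {K : (Fin n → ℝ) → ℝ≥0∞} (hK : Measurable K) :
    ∫⁻ y, K y ∂tensorPower (density f) n = ∫⁻ y, K y * ∏ i, ENNReal.ofReal (f (y i)) := by
  induction n with
  | zero =>
    rw [tensorPower, volume_pi, Measure.pi_of_empty, Measure.pi_of_empty]
    simp
  | succ n ih =>
    have hprod : Measurable fun y : Fin (n + 1) → ℝ => ∏ i, ENNReal.ofReal (f (y i)) := by fun_prop
    have hsucc : ∫⁻ y, K y * ∏ i, ENNReal.ofReal (f (y i)) = ∫⁻ y : Fin n → ℝ, ∫⁻ z, _ :=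
      lintegral_tensorPower_succ volume (hK.mul hprod)
    rw [lintegral_tensorPower_succ _ hK, hsucc, ih (Measurable.lintegral_prod_right'
      (f := fun p : (Fin n → ℝ) × ℝ => K (Fin.snoc p.1 p.2)) (by fun_prop))]
    refine lintegral_congr fun y => ?_
    have hKy : Measurable fun z => K (Fin.snoc y z) :=
      hK.comp (measurable_finSnoc.comp measurable_prodMk_left)
    rw [density, lintegral_withDensity_eq_lintegral_mul _ (by fun_prop) hKy,
      ← lintegral_mul_const _ (by fun_prop)]
    refine lintegral_congr fun z => ?_
    simp only [Pi.mul_apply, Fin.prod_univ_castSucc, Fin.snoc_castSucc, Fin.snoc_last]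
    ring

lemma lintegral_eq_ofReal_pow_mul_lintegral_comp_smul {n : ℕ} {a : ℝ} (ha : 0 < a)
    {G : (Fin n → ℝ) → ℝ≥0∞} (hG : Measurable G) :
    ∫⁻ y, G y = ENNReal.ofReal (a ^ n) * ∫⁻ y, G (a • y) := by
  have hsmul : ∫⁻ y, G (a • y) = ENNReal.ofReal |(a ^ n)⁻¹| * ∫⁻ y, G y := by
    rw [← lintegral_map hG (measurable_const_smul a), Measure.map_addHaar_smul _ ha.ne',
      lintegral_smul_measure, Module.finrank_fin_fun, smul_eq_mul]
  rw [hsmul, ← mul_assoc, ← ENNReal.ofReal_mul (by positivity), abs_of_pos (by positivity),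
    mul_inv_cancel₀ (by positivity), ENNReal.ofReal_one, one_mul]

end ProductIntegrals

section Slicing

lemma sqDensity_const_mul (a : ℝ≥0∞) (g : ℝ → ℝ≥0∞) (w : ℝ) :
    sqDensity (fun z => a * g z) w = a * sqDensity g w := by
  unfold sqDensity
  by_cases hw : w ∈ Set.Ioi (0 : ℝ)
  · rw [Set.indicator_of_mem hw, Set.indicator_of_mem hw]
    ring
  · rw [Set.indicator_of_notMem hw, Set.indicator_of_notMem hw, mul_zero]

lemma sqDensity_congr {g h : ℝ → ℝ≥0∞} {w : ℝ} (hgh : ∀ z, z ^ 2 = w → g z = h z) :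
    sqDensity g w = sqDensity h w := by
  unfold sqDensity
  by_cases hw : w ∈ Set.Ioi (0 : ℝ)
  · rw [Set.indicator_of_mem hw, Set.indicator_of_mem hw, hgh _ (Real.sq_sqrt (le_of_lt hw)),
      hgh _ ((neg_sq _).trans (Real.sq_sqrt (le_of_lt hw)))]
  · rw [Set.indicator_of_notMem hw, Set.indicator_of_notMem hw]

lemma sqDensity_comp_inv_mul (g : ℝ → ℝ≥0∞) {a : ℝ} (ha : 0 < a) (w : ℝ) :
    sqDensity (fun z => g (a⁻¹ * z)) (a ^ 2 * w) = ENNReal.ofReal a⁻¹ * sqDensity g w := by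
  unfold sqDensity
  by_cases hw : w ∈ Set.Ioi (0 : ℝ)
  · have hw' : a ^ 2 * w ∈ Set.Ioi (0 : ℝ) := mul_pos (pow_pos ha 2) hw
    rw [Set.indicator_of_mem hw, Set.indicator_of_mem hw', Real.sqrt_mul (by positivity),
      Real.sqrt_sq ha.le]
    beta_reduce
    rw [mul_neg, inv_mul_cancel_left₀ ha.ne', ← mul_assoc (ENNReal.ofReal _),
      ← ENNReal.ofReal_mul (by positivity), mul_left_comm, one_div, mul_inv, one_div]
  · have hw' : a ^ 2 * w ∉ Set.Ioi (0 : ℝ) := fun h =>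
      hw (pos_of_mul_pos_right h (pow_pos ha 2).le)
    rw [Set.indicator_of_notMem hw, Set.indicator_of_notMem hw', mul_zero]

/-- The integral of `F` over the sphere `∑ i, x i ^ 2 = t` against the surface measure divided by
the gradient of `x ↦ ∑ i, x i ^ 2`, computed in the coordinates `(y, ±√(t - ∑ i, y i ^ 2))`. -/
def sliceIntegral {n : ℕ} (F : (Fin (n + 1) → ℝ) → ℝ≥0∞) (t : ℝ) : ℝ≥0∞ :=
  ∫⁻ y : Fin n → ℝ, sqDensity (fun z => F (Fin.snoc y z)) (t - ∑ i, y i ^ 2)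

variable {n : ℕ} {F G : (Fin (n + 1) → ℝ) → ℝ≥0∞}

lemma sum_snoc_sq (y : Fin n → ℝ) (z : ℝ) :
    ∑ i, (Fin.snoc y z : Fin (n + 1) → ℝ) i ^ 2 = ∑ i, y i ^ 2 + z ^ 2 := by
  simp [Fin.sum_univ_castSucc]

lemma smul_snoc (a : ℝ) (y : Fin n → ℝ) (z : ℝ) :
    a • (Fin.snoc y z : Fin (n + 1) → ℝ) = Fin.snoc (a • y) (a * z) := by
  ext i
  refine Fin.lastCases ?_ (fun j => ?_) i <;> simp

lemma measurable_sqDensity_snoc (hF : Measurable F) :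
    Measurable fun p : (Fin n → ℝ) × ℝ =>
      sqDensity (fun z => F (Fin.snoc p.1 z)) (p.2 - ∑ i, p.1 i ^ 2) := by
  unfold sqDensity
  simp only [Set.indicator_apply]
  refine Measurable.ite ((?_ : Measurable fun p : (Fin n → ℝ) × ℝ => p.2 - ∑ i, p.1 i ^ 2)
    measurableSet_Ioi) ?_ measurable_const <;> fun_prop

lemma lintegral_comp_sum_sq_mul (hF : Measurable F) {h : ℝ → ℝ≥0∞} (hh : Measurable h) :
    ∫⁻ x, h (∑ i, x i ^ 2) * F x = ∫⁻ t, h t * sliceIntegral F t := by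
  have hslice := measurable_sqDensity_snoc hF
  calc ∫⁻ x, h (∑ i, x i ^ 2) * F x
      = ∫⁻ y : Fin n → ℝ, ∫⁻ z, h (z ^ 2 + ∑ i, y i ^ 2) * F (Fin.snoc y z) := by
        refine (lintegral_tensorPower_succ volume (K := fun x => h (∑ i, x i ^ 2) * F x)
          (by fun_prop)).trans ?_
        simp only [sum_snoc_sq, add_comm]
        rfl
    _ = ∫⁻ y : Fin n → ℝ, ∫⁻ t, h t * sqDensity (fun z => F (Fin.snoc y z)) (t - ∑ i, y i ^ 2) := by
        refine lintegral_congr fun y => ?_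
        rw [lintegral_comp_sq_mul (g := fun z => F (Fin.snoc y z))
          (h := fun w => h (w + ∑ i, y i ^ 2))
          (hF.comp (measurable_finSnoc.comp measurable_prodMk_left)) (by fun_prop),
          ← lintegral_sub_right_eq_self _ (∑ i, y i ^ 2)]
        simp only [sub_add_cancel]
    _ = ∫⁻ t, h t * sliceIntegral F t := by
        rw [lintegral_lintegral_swap (by fun_prop)]
        refine lintegral_congr fun t => lintegral_const_mul _ ?_
        exact hslice.comp measurable_prodMk_right

lemma sliceIntegral_congr {t : ℝ} (hFG : ∀ x, ∑ i, x i ^ 2 = t → F x = G x) :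
    sliceIntegral F t = sliceIntegral G t :=
  lintegral_congr fun y => sqDensity_congr fun z hz =>
    hFG _ (by rw [sum_snoc_sq, hz, add_sub_cancel])

lemma sliceIntegral_comp_inv_smul (hF : Measurable F) {a : ℝ} (ha : 0 < a) (t : ℝ) :
    sliceIntegral (fun x => F (a⁻¹ • x)) (a ^ 2 * t) =
      ENNReal.ofReal (a ^ n) * ENNReal.ofReal a⁻¹ * sliceIntegral F t := by
  have hslice : Measurable fun y : Fin n → ℝ =>
      sqDensity (fun z => F (a⁻¹ • Fin.snoc y z)) (a ^ 2 * t - ∑ i, y i ^ 2) :=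
    (measurable_sqDensity_snoc (F := fun x => F (a⁻¹ • x)) (by fun_prop)).comp
      measurable_prodMk_right
  rw [sliceIntegral, lintegral_eq_ofReal_pow_mul_lintegral_comp_smul ha hslice, mul_assoc,
    sliceIntegral, ← lintegral_const_mul' (ENNReal.ofReal a⁻¹) _ ENNReal.ofReal_ne_top]
  congr 1
  refine lintegral_congr fun y => ?_
  rw [← sqDensity_comp_inv_mul _ ha]
  simp only [smul_snoc, smul_smul, inv_mul_cancel₀ ha.ne', one_smul, Pi.smul_apply, smul_eq_mul,
    mul_pow, ← Finset.mul_sum, mul_sub]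

lemma lintegral_unif_eq_lintegral_sum_sq {N : ℕ} {F : (Fin N → ℝ) → ℝ≥0∞} (hF : Measurable F) :
    ∫⁻ v : KacSphere N, F (fun i => v.1 i) ∂unif N = (surfaceMeasure N Set.univ)⁻¹ *
      (N * ∫⁻ x : Fin N → ℝ, (Set.Ioo (0 : ℝ) 1).indicator 1 (∑ i, x i ^ 2) *
        F ((√N / √(∑ i, x i ^ 2)) • x)) := by
  rw [lintegral_unif_eq_setLIntegral_ball (F := fun v => F fun i => v i) (by fun_prop),
    ← lintegral_indicator (measurableSet_ball.diff (measurableSet_singleton 0)),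
    ← (PiLp.volume_preserving_ofLp (Fin N)).lintegral_comp_emb
      (MeasurableEquiv.toLp 2 (Fin N → ℝ)).symm.measurableEmbedding]
  congr 3 with x
  have hmem : x ∈ Metric.ball 0 1 \ {0} ↔ ‖x‖ ^ 2 ∈ Set.Ioo (0 : ℝ) 1 := by
    rw [Set.mem_Ioo, sq_lt_one_iff₀ (norm_nonneg x), sq_pos_iff, norm_ne_zero_iff, and_comm]
    simp
  rw [← EuclideanSpace.real_norm_sq_eq, Real.sqrt_sq (norm_nonneg x)]
  by_cases hx : x ∈ Metric.ball 0 1 \ {0}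
  · rw [Set.indicator_of_mem hx, Set.indicator_of_mem (hmem.1 hx), Pi.one_apply, one_mul]
    rfl
  · rw [Set.indicator_of_notMem hx, Set.indicator_of_notMem (mt hmem.2 hx), zero_mul]

/-- The factor relating the uniform measure on `S^n(√(n+1))` to `sliceIntegral`. -/
def sliceConst (n : ℕ) : ℝ≥0∞ :=
  (sliceIntegral (fun _ : Fin (n + 1) → ℝ => 1) ((n + 1 : ℕ) : ℝ))⁻¹

lemma exists_lintegral_unif_eq_mul_sliceIntegral (n : ℕ) : ∃ c : ℝ≥0∞,
    ∀ F : (Fin (n + 1) → ℝ) → ℝ≥0∞, Measurable F →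
      ∫⁻ v : KacSphere (n + 1), F (fun i => v.1 i) ∂unif (n + 1) =
        c * sliceIntegral F ((n + 1 : ℕ) : ℝ) := by
  let N : ℝ := ((n + 1 : ℕ) : ℝ)
  have hN : 0 < N := by positivity
  have hlevel : ∀ F : (Fin (n + 1) → ℝ) → ℝ≥0∞, Measurable F → ∀ t ∈ Set.Ioo (0 : ℝ) 1,
      sliceIntegral (fun x => F ((√N / √(∑ i, x i ^ 2)) • x)) t =
        ENNReal.ofReal (√(t / N) ^ n) * ENNReal.ofReal (√(t / N))⁻¹ * sliceIntegral F N := by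
    intro F hF t ht
    have htN : 0 < t / N := div_pos ht.1 hN
    rw [← sliceIntegral_comp_inv_smul hF (Real.sqrt_pos.2 htN), Real.sq_sqrt htN.le,
      div_mul_cancel₀ _ hN.ne', Real.sqrt_div ht.1.le, inv_div]
    exact sliceIntegral_congr fun x hx => by rw [hx]
  refine ⟨(surfaceMeasure (n + 1) Set.univ)⁻¹ * ((n + 1 : ℕ) * ∫⁻ t in Set.Ioo (0 : ℝ) 1,
    ENNReal.ofReal (√(t / N) ^ n) * ENNReal.ofReal (√(t / N))⁻¹), fun F hF => ?_⟩
  rw [lintegral_unif_eq_lintegral_sum_sq hF,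
    lintegral_comp_sum_sq_mul (F := fun x => F ((√N / √(∑ i, x i ^ 2)) • x)) (by fun_prop)
      (measurable_one.indicator measurableSet_Ioo), mul_assoc, mul_assoc,
    ← lintegral_mul_const _ (by fun_prop), ← lintegral_indicator measurableSet_Ioo]
  congr 3 with t
  by_cases ht : t ∈ Set.Ioo (0 : ℝ) 1
  · rw [Set.indicator_of_mem ht, Set.indicator_of_mem ht, Pi.one_apply, one_mul, hlevel F hF t ht]
  · rw [Set.indicator_of_notMem ht, Set.indicator_of_notMem ht, zero_mul]

theorem lintegral_unif (n : ℕ) {F : (Fin (n + 1) → ℝ) → ℝ≥0∞} (hF : Measurable F) :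
    ∫⁻ v : KacSphere (n + 1), F (fun i => v.1 i) ∂unif (n + 1) =
      sliceConst n * sliceIntegral F ((n + 1 : ℕ) : ℝ) := by
  have := isProbabilityMeasure_unif n.succ_ne_zero
  obtain ⟨c, hc⟩ := exists_lintegral_unif_eq_mul_sliceIntegral n
  have hone := hc (fun _ => 1) measurable_const
  rw [lintegral_one, measure_univ] at hone
  rw [hc F hF, ENNReal.eq_inv_of_mul_eq_one_left hone.symm, sliceConst]

lemma sliceConst_mul_sliceIntegral_one (n : ℕ) :
    sliceConst n * sliceIntegral (fun _ : Fin (n + 1) → ℝ => 1) ((n + 1 : ℕ) : ℝ) = 1 := by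
  have := isProbabilityMeasure_unif n.succ_ne_zero
  rw [← lintegral_unif n measurable_const, lintegral_one, measure_univ]

lemma sliceConst_ne_zero (n : ℕ) : sliceConst n ≠ 0 :=
  left_ne_zero_of_mul_eq_one (sliceConst_mul_sliceIntegral_one n)

lemma sliceConst_ne_top (n : ℕ) : sliceConst n ≠ ∞ :=
  ENNReal.inv_ne_top.2 (right_ne_zero_of_mul_eq_one (sliceConst_mul_sliceIntegral_one n))

end Slicing

section ProductDensities

variable {f : ℝ → ℝ} (hf : Measurable f)

include hf

lemma sliceIntegral_mul_prod {n : ℕ} {G : (Fin n → ℝ) → ℝ≥0∞} (hG : Measurable G) (t : ℝ) :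
    sliceIntegral (fun x => G (fun i => x i.castSucc) * ∏ j, ENNReal.ofReal (f (x j))) t =
      ∫⁻ y, G y * sqDensity (fun v => ENNReal.ofReal (f v)) (t - ∑ i, y i ^ 2)
        ∂tensorPower (density f) n := by
  have : Measurable (sqDensity fun v => ENNReal.ofReal (f v)) :=
    measurable_sqDensity (by fun_prop)
  rw [lintegral_tensorPower_density hf (by fun_prop), sliceIntegral]
  refine lintegral_congr fun y => ?_
  simp only [Fin.prod_univ_castSucc, Fin.snoc_castSucc, Fin.snoc_last, ← mul_assoc]
  rw [sqDensity_const_mul]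
  ring

lemma lintegral_mul_sqDensity_eq_lintegral_mul_sumSqDensity {k m : ℕ} {G : (Fin k → ℝ) → ℝ≥0∞}
    (hG : Measurable G) (t : ℝ) :
    ∫⁻ y, G (fun i => y (Fin.castAdd m i)) *
        sqDensity (fun v => ENNReal.ofReal (f v)) (t - ∑ i, y i ^ 2)
        ∂tensorPower (density f) (k + m) =
      ∫⁻ x, G x * sumSqDensity f m (t - ∑ i, x i ^ 2) ∂tensorPower (density f) k := by
  have : Measurable (sqDensity fun v => ENNReal.ofReal (f v)) :=
    measurable_sqDensity (by fun_prop)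
  rw [lintegral_tensorPower_add _ (by fun_prop)]
  refine lintegral_congr fun x => ?_
  simp only [Fin.append_left, Fin.append_right, Fin.sum_univ_add, ← sub_sub]
  exact lintegral_const_mul _ (by fun_prop)

theorem lintegral_unif_mul_prod {k m : ℕ} {G : (Fin k → ℝ) → ℝ≥0∞} (hG : Measurable G) :
    ∫⁻ v : KacSphere (k + m + 1), G (fun i => v.1 (Fin.castLE (by omega) i)) *
        ∏ j, ENNReal.ofReal (f (v.1 j)) ∂unif (k + m + 1) =
      sliceConst (k + m) * ∫⁻ x, G x * sumSqDensity f m (((k + m + 1 : ℕ) : ℝ) - ∑ i, x i ^ 2)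
        ∂tensorPower (density f) k := by
  rw [← lintegral_mul_sqDensity_eq_lintegral_mul_sumSqDensity hf hG,
    ← sliceIntegral_mul_prod hf (G := fun y => G fun i => y (Fin.castAdd m i)) (by fun_prop)]
  exact lintegral_unif (k + m) (F := fun x => G (fun i => x (Fin.castAdd m i).castSucc) *
    ∏ j, ENNReal.ofReal (f (x j))) (by fun_prop)

lemma Z_succ (n : ℕ) :
    Z f (n + 1) = sliceConst n * sumSqDensity f n ((n + 1 : ℕ) : ℝ) := by
  have hslice := sliceIntegral_mul_prod hf (n := n) (G := fun _ => 1) measurable_const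
  simp only [one_mul] at hslice
  rw [sumSqDensity, ← hslice, ← lintegral_unif n (by fun_prop), Z]

end ProductDensities

section KLDivWithDensity

open InformationTheory

lemma klFun_le_sq {x : ℝ} (hx : 0 ≤ x) : klFun x ≤ (x - 1) ^ 2 := by
  rw [klFun_apply]
  rcases hx.eq_or_lt with rfl | hpos
  · simp
  · nlinarith [Real.log_le_sub_one_of_pos hpos]

variable {α : Type*} [MeasurableSpace α] {ν : Measure α} [IsFiniteMeasure ν]

lemma klDiv_withDensity_left {ρ : α → ℝ≥0∞} (hρ : Measurable ρ)
    [IsFiniteMeasure (ν.withDensity ρ)] :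
    klDiv (ν.withDensity ρ) ν = ∫⁻ x, ENNReal.ofReal (klFun (ρ x).toReal) ∂ν := by
  rw [klDiv_eq_lintegral_klFun_of_ac (withDensity_absolutelyContinuous ν ρ)]
  refine lintegral_congr_ae ?_
  filter_upwards [Measure.rnDeriv_withDensity ν hρ] with x hx
  rw [hx]

lemma tendsto_klDiv_withDensity_zero {ι : Type*} {l : Filter ι} [l.IsCountablyGenerated]
    {ρ : ι → α → ℝ≥0∞} (hρ : ∀ i, Measurable (ρ i)) {C : ℝ≥0} (hC : ∀ᶠ i in l, ∀ x, ρ i x ≤ C)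
    (hlim : ∀ x, Tendsto (fun i => ρ i x) l (𝓝 1)) :
    Tendsto (fun i => klDiv (ν.withDensity (ρ i)) ν) l (𝓝 0) := by
  have hkl : ∀ᶠ i in l, ∫⁻ x, ENNReal.ofReal (klFun (ρ i x).toReal) ∂ν =
      klDiv (ν.withDensity (ρ i)) ν := by
    filter_upwards [hC] with i hi
    have : IsFiniteMeasure (ν.withDensity (ρ i)) := isFiniteMeasure_withDensity
      ((lintegral_mono hi).trans_lt (by simp [ENNReal.mul_lt_top, measure_lt_top])).ne
    exact (klDiv_withDensity_left (hρ i)).symm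
  refine Tendsto.congr' hkl ?_
  rw [← lintegral_zero (μ := ν)]
  refine tendsto_lintegral_filter_of_dominated_convergence
    (fun _ => ENNReal.ofReal ((C + 1) ^ 2)) ?_ ?_
    (by simp [ENNReal.mul_eq_top]) (ae_of_all _ fun x => ?_)
  · exact Eventually.of_forall fun i => by fun_prop
  · filter_upwards [hC] with i hi
    refine ae_of_all _ fun x => ENNReal.ofReal_le_ofReal ?_
    have hle : (ρ i x).toReal ≤ C := ENNReal.toReal_mono ENNReal.coe_ne_top (hi x)
    refine (klFun_le_sq ENNReal.toReal_nonneg).trans ?_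
    nlinarith [ENNReal.toReal_nonneg (a := ρ i x)]
  · have h := (continuous_klFun.tendsto _).comp
      ((ENNReal.tendsto_toReal ENNReal.one_ne_top).comp (hlim x))
    rw [ENNReal.toReal_one, klFun_one] at h
    simpa only [Function.comp_def, ENNReal.ofReal_zero] using ENNReal.tendsto_ofReal h

end KLDivWithDensity

section CondProd

variable {f : ℝ → ℝ}

@[fun_prop]
lemma measurable_coord {N : ℕ} (j : Fin N) : Measurable fun v : KacSphere N => v.1 j :=
  ((measurable_pi_apply j).comp (WithLp.measurable_ofLp 2 _)).comp measurable_subtype_coe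

lemma measurable_coords {N : ℕ} {ι : Type*} (e : ι → Fin N) :
    Measurable fun (v : KacSphere N) (i : ι) => v.1 (e i) := by
  fun_prop

lemma lintegral_condProd (hf : Measurable f) {N : ℕ} {F : KacSphere N → ℝ≥0∞}
    (hF : Measurable F) :
    ∫⁻ v, F v ∂condProd f N =
      (∫⁻ v, F v * ∏ j, ENNReal.ofReal (f (v.1 j)) ∂unif N) * (Z f N)⁻¹ := by
  rw [condProd, lintegral_withDensity_eq_lintegral_mul _ (by fun_prop) hF,
    ← lintegral_mul_const _ (by fun_prop)]
  refine lintegral_congr fun v => ?_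
  rw [Pi.mul_apply, div_eq_mul_inv]
  ring

lemma isProbabilityMeasure_condProd {N : ℕ} (h0 : Z f N ≠ 0) (htop : Z f N ≠ ∞) :
    IsProbabilityMeasure (condProd f N) := by
  constructor
  simp only [condProd, withDensity_apply _ MeasurableSet.univ, setLIntegral_univ, div_eq_mul_inv]
  rw [lintegral_mul_const' _ _ (ENNReal.inv_ne_top.2 h0)]
  exact ENNReal.mul_inv_cancel h0 htop

lemma isSymm_condProd (hf : Measurable f) (N : ℕ) : IsSymm (condProd f N) := by
  intro τ
  refine Measure.ext_of_lintegral _ fun (F : (Fin N → ℝ) → ℝ≥0∞) hF => ?_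
  rw [lintegral_map hF (measurable_coords _), lintegral_map hF (measurable_coords _),
    lintegral_condProd hf (by fun_prop), lintegral_condProd hf (by fun_prop),
    ← lintegral_unif_comp_perm τ (F := fun x => F x * ∏ j, ENNReal.ofReal (f (x j)))
      (by fun_prop)]
  simp only [Equiv.prod_comp τ fun _ => ENNReal.ofReal (f _)]

end CondProd

section Marginals

/-- The density of `P_k [μ^{⊗(k+m+1)}]` with respect to `μ^{⊗k}`, for `μ = f(v) dv`. -/
def marginalDensity (f : ℝ → ℝ) (k m : ℕ) (x : Fin k → ℝ) : ℝ≥0∞ :=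
  sumSqDensity f m (((k + m + 1 : ℕ) : ℝ) - ∑ i, x i ^ 2) /
    sumSqDensity f (k + m) ((k + m + 1 : ℕ) : ℝ)

variable {f : ℝ → ℝ} (hf : IsKacDensity f)

include hf

lemma measurable_marginalDensity (k m : ℕ) : Measurable (marginalDensity f k m) :=
  ((measurable_sumSqDensity hf m).comp
    (measurable_const.sub (measurable_sum_sq k))).div_const _

lemma marginal_condProd (k m : ℕ) : marginal k (condProd f (k + m + 1)) =
    (tensorPower (density f) k).withDensity (marginalDensity f k m) := by
  have := measurable_sumSqDensity hf m
  have := measurable_marginalDensity hf k m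
  have hk : k ≤ k + m + 1 := by lia
  rw [marginal, dif_pos hk]
  refine Measure.ext_of_lintegral _ fun G hG => ?_
  rw [lintegral_map hG (measurable_coords _),
    lintegral_condProd hf.measurable (F := fun v => G fun i => v.1 (Fin.castLE hk i)) (by fun_prop),
    lintegral_unif_mul_prod hf.measurable hG, Z_succ hf.measurable,
    ENNReal.mul_inv (Or.inl (sliceConst_ne_zero _)) (Or.inl (sliceConst_ne_top _)),
    mul_mul_mul_comm, ENNReal.mul_inv_cancel (sliceConst_ne_zero _) (sliceConst_ne_top _), one_mul,
    ← lintegral_mul_const _ (by fun_prop),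
    lintegral_withDensity_eq_lintegral_mul _ (by fun_prop) hG]
  refine lintegral_congr fun x => ?_
  rw [Pi.mul_apply, marginalDensity, div_eq_mul_inv]
  ring

lemma sumSqDensity_ne_top {m : ℕ} (hm : 4 ≤ m) (r : ℝ) : sumSqDensity f m r ≠ ∞ := by
  obtain ⟨C, hC⟩ := exists_sqrt_mul_sumSqDensity_le hf
  intro htop
  have h := hC m hm r
  rw [htop, ENNReal.mul_top (by simp; lia)] at h
  exact ENNReal.ofReal_ne_top (top_le_iff.1 h)

lemma exists_eventually_le_sqrt_mul_sumSqDensity : ∃ a > 0, ∀ᶠ n : ℕ in atTop,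
    a ≤ √n * (sumSqDensity f n ((n + 1 : ℕ) : ℝ)).toReal := by
  have hvar := hf.variance_sqLaw_pos
  have hpos : 0 < (√(2 * π * Var[fun x => x; sqLaw (density f)]))⁻¹ := by positivity
  refine ⟨_, half_pos hpos, ?_⟩
  filter_upwards [(tendsto_sqrt_mul_sumSqDensity hf 1).eventually_const_le (half_lt_self hpos)]
    with n hn
  rwa [Nat.cast_add_one]

lemma eventually_sumSqDensity_ne_zero :
    ∀ᶠ n : ℕ in atTop, sumSqDensity f n ((n + 1 : ℕ) : ℝ) ≠ 0 := by
  obtain ⟨a, ha, hlow⟩ := exists_eventually_le_sqrt_mul_sumSqDensity hf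
  filter_upwards [hlow] with n hn h0
  rw [h0, ENNReal.toReal_zero, mul_zero] at hn
  exact ha.not_ge hn

theorem eventually_Z_pos_lt_top : ∀ᶠ N in atTop, 0 < Z f N ∧ Z f N < ∞ := by
  rw [← map_add_atTop_eq_nat 1, eventually_map]
  filter_upwards [eventually_sumSqDensity_ne_zero hf, eventually_ge_atTop 4] with n hn h4
  rw [Z_succ hf.measurable]
  exact ⟨ENNReal.mul_pos (sliceConst_ne_zero _) hn,
    ENNReal.mul_lt_top (sliceConst_ne_top _).lt_top (sumSqDensity_ne_top hf h4 _).lt_top⟩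

lemma exists_marginalDensity_le : ∃ C > 0, ∀ᶠ n : ℕ in atTop, ∀ k m : ℕ, k + m = n → 4 ≤ m →
    ∀ x, marginalDensity f k m x ≤ ENNReal.ofReal (C * (√n / √m)) := by
  obtain ⟨B, hB⟩ := exists_sqrt_mul_sumSqDensity_le hf
  obtain ⟨a, ha, hlow⟩ := exists_eventually_le_sqrt_mul_sumSqDensity hf
  refine ⟨max B 1 / a, by positivity, ?_⟩
  filter_upwards [hlow] with n hn k m hkm hm x
  subst hkm
  have hup : √m * (sumSqDensity f m (((k + m + 1 : ℕ) : ℝ) - ∑ i, x i ^ 2)).toReal ≤ max B 1 := by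
    rw [← ENNReal.ofReal_le_ofReal_iff (by positivity), ENNReal.ofReal_mul (by positivity),
      ENNReal.ofReal_toReal (sumSqDensity_ne_top hf hm _)]
    exact (hB m hm _).trans (ENNReal.ofReal_le_ofReal (le_max_left _ _))
  have hden : 0 < (sumSqDensity f (k + m) ((k + m + 1 : ℕ) : ℝ)).toReal :=
    pos_of_mul_pos_right (ha.trans_le hn) (by positivity)
  have hsqrt : 0 < √(m : ℝ) := by positivity
  rw [marginalDensity, ← ENNReal.ofReal_toReal (sumSqDensity_ne_top hf hm _),
    ← ENNReal.ofReal_toReal (sumSqDensity_ne_top hf (by lia : 4 ≤ k + m) _),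
    ← ENNReal.ofReal_div_of_pos hden]
  refine ENNReal.ofReal_le_ofReal ?_
  rw [div_le_iff₀ hden, ← mul_le_mul_iff_right₀ hsqrt]
  calc √m * (sumSqDensity f m (((k + m + 1 : ℕ) : ℝ) - ∑ i, x i ^ 2)).toReal
      ≤ max B 1 / a * a := by rwa [div_mul_cancel₀ _ ha.ne']
    _ ≤ max B 1 / a * (√(k + m : ℕ) *
          (sumSqDensity f (k + m) ((k + m + 1 : ℕ) : ℝ)).toReal) := by gcongr
    _ = _ := by field_simp

lemma exists_marginal_condProd_le_smul : ∃ C > 0, ∀ᶠ N : ℕ in atTop, ∀ k : ℕ, k + 5 ≤ N →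
    marginal k (condProd f N) ≤ ENNReal.ofReal (C * √N) • tensorPower (density f) k := by
  obtain ⟨C, hC, hle⟩ := exists_marginalDensity_le hf
  refine ⟨C, hC, ?_⟩
  rw [← map_add_atTop_eq_nat 1, eventually_map]
  filter_upwards [hle] with n hn k hk
  obtain ⟨m, rfl⟩ : ∃ m, n = k + m := ⟨n - k, by lia⟩
  rw [marginal_condProd hf, ← withDensity_const]
  refine withDensity_mono (ae_of_all _ fun x => (hn k m rfl (by lia) x).trans ?_)
  have h1 : 1 ≤ √(m : ℝ) := Real.one_le_sqrt.2 (by exact_mod_cast (by lia : 1 ≤ m))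
  have h2 : √((k + m : ℕ) : ℝ) / √m ≤ √((k + m + 1 : ℕ) : ℝ) :=
    (div_le_self (by positivity) h1).trans (Real.sqrt_le_sqrt (by push_cast; linarith))
  exact ENNReal.ofReal_le_ofReal (by gcongr)

omit hf in
lemma tendsto_sqrt_add_div_sqrt (k : ℕ) :
    Tendsto (fun m : ℕ => √(k + m : ℕ) / √m) atTop (𝓝 1) := by
  have h : Tendsto (fun m : ℕ => √((k : ℝ) / m + 1)) atTop (𝓝 √(0 + 1)) :=
    ((tendsto_const_div_atTop_nhds_zero_nat (k : ℝ)).add_const 1).sqrt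
  rw [zero_add, Real.sqrt_one] at h
  refine h.congr' ?_
  filter_upwards [eventually_gt_atTop 0] with m hm
  rw [← Real.sqrt_div (by positivity), Nat.cast_add]
  field_simp

lemma tendsto_marginalDensity (k : ℕ) (x : Fin k → ℝ) :
    Tendsto (fun m => marginalDensity f k m x) atTop (𝓝 1) := by
  have hvar := hf.variance_sqLaw_pos
  have hL : (√(2 * π * Var[fun x => x; sqLaw (density f)]))⁻¹ ≠ 0 := by positivity
  have hnum := tendsto_sqrt_mul_sumSqDensity hf ((k : ℝ) + 1 - ∑ i, x i ^ 2)
  have hden := (tendsto_add_atTop_iff_nat k).2 (tendsto_sqrt_mul_sumSqDensity hf 1)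
  have h := (hnum.div hden hL).mul (tendsto_sqrt_add_div_sqrt k)
  rw [div_self hL, one_mul] at h
  have hreal := ENNReal.tendsto_ofReal h
  rw [ENNReal.ofReal_one] at hreal
  obtain ⟨C, -, hle⟩ := exists_marginalDensity_le hf
  refine hreal.congr' ?_
  filter_upwards [(tendsto_add_atTop_nat k).eventually hle, eventually_ge_atTop 4] with m hm h4
  have htop := ((hm k m (add_comm k m) h4 x).trans_lt ENNReal.ofReal_lt_top).ne
  have hshift : ((k + m + 1 : ℕ) : ℝ) - ∑ i, x i ^ 2 = m + ((k : ℝ) + 1 - ∑ i, x i ^ 2) := by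
    push_cast
    ring
  have hm0 : √(m : ℝ) ≠ 0 := by positivity
  have hkm0 : √((k + m : ℕ) : ℝ) ≠ 0 := by positivity
  rw [← ENNReal.ofReal_toReal htop, marginalDensity, ENNReal.toReal_div, hshift,
    Nat.cast_add_one, Pi.div_apply, add_comm m k]
  field_simp

theorem tendsto_klDiv_marginal_condProd (k : ℕ) :
    Tendsto (fun N => InformationTheory.klDiv (marginal k (condProd f N))
      (tensorPower (density f) k)) atTop (𝓝 0) := by
  have := hf.isProbabilityMeasure
  obtain ⟨C, hC, hle⟩ := exists_marginalDensity_le hf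
  rw [← tendsto_add_atTop_iff_nat (k + 1)]
  refine Tendsto.congr (fun m => by rw [← marginal_condProd hf, add_assoc, add_left_comm])
    <| tendsto_klDiv_withDensity_zero (measurable_marginalDensity hf k)
      (C := (C * 2).toNNReal) ?_ (tendsto_marginalDensity hf k)
  filter_upwards [(tendsto_add_atTop_nat k).eventually hle, eventually_ge_atTop 4,
    (tendsto_sqrt_add_div_sqrt k).eventually_le_const one_lt_two] with m hm h4 h2 x
  refine (hm k m (add_comm k m) h4 x).trans (ENNReal.ofReal_le_ofReal ?_)
  rw [add_comm m k]
  gcongr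

end Marginals

section DonskerVaradhan

open InformationTheory

lemma mul_le_klFun_add_exp {x : ℝ} (hx : 0 ≤ x) (y : ℝ) :
    x * y ≤ klFun x + (Real.exp y - 1) := by
  rw [klFun_apply]
  rcases hx.eq_or_lt with rfl | hx
  · simp only [zero_mul, Real.log_zero, zero_add, sub_zero, add_sub_cancel]
    positivity
  · have tangent := Real.add_one_le_exp (y - Real.log x)
    rw [Real.exp_sub, Real.exp_log hx, le_div_iff₀ hx] at tangent
    linarith

variable {α : Type*} {mα : MeasurableSpace α} {P Q ν : Measure α} {X : α → ℝ} {C : ℝ}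

lemma integrableExpSet_subset_of_le_smul (hle : Q ≤ ENNReal.ofReal C • ν) :
    integrableExpSet X ν ⊆ integrableExpSet X Q := fun _ ht =>
  (ht.smul_measure ENNReal.ofReal_ne_top).mono_measure hle

lemma zero_mem_interior_integrableExpSet_neg (hX : 0 ∈ interior (integrableExpSet X ν)) :
    0 ∈ interior (integrableExpSet (-X) ν) := by
  rw [mem_interior_iff_mem_nhds] at hX ⊢
  have : Tendsto (fun t : ℝ => -t) (𝓝 0) (𝓝 0) := by simpa using (continuous_neg (G := ℝ)).tendsto 0
  filter_upwards [this hX] with t ht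
  simpa [integrableExpSet] using ht

lemma exists_integrable_exp_mul_abs (hX : 0 ∈ interior (integrableExpSet X ν)) :
    ∃ t > 0, Integrable (fun x => Real.exp (t * |X x|)) ν := by
  have hX' := zero_mem_interior_integrableExpSet_neg hX
  rw [mem_interior_iff_mem_nhds] at hX hX'
  have hright : ∀ᶠ t in 𝓝[>] (0 : ℝ), t ∈ integrableExpSet X ν ∩ integrableExpSet (-X) ν :=
    nhdsWithin_le_nhds (inter_mem hX hX')
  obtain ⟨t, ⟨hp, hn⟩, ht⟩ := (hright.and self_mem_nhdsWithin).exists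
  refine ⟨t, ht, integrable_exp_mul_abs hp ?_⟩
  simpa [integrableExpSet] using hn

/-- The slope at `0` of the cumulant generating function is the mean. -/
lemma exists_cgf_div_lt [IsProbabilityMeasure ν] (hX : 0 ∈ interior (integrableExpSet X ν)) {a : ℝ}
    (ha : ∫ x, X x ∂ν < a) : ∃ t > 0, t ∈ integrableExpSet X ν ∧ cgf X ν t / t < a := by
  have hderiv : HasDerivAt (cgf X ν) (∫ x, X x ∂ν) 0 := by
    simpa [deriv_cgf_zero hX] using (analyticAt_cgf hX).differentiableAt.hasDerivAt
  have hslope := (hasDerivAt_iff_tendsto_slope_zero.1 hderiv).mono_left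
    (nhdsWithin_mono 0 fun x (hx : x ∈ Set.Ioi (0 : ℝ)) => (ne_of_gt hx : x ≠ 0))
  obtain ⟨t, ⟨hta, htX⟩, ht⟩ := (((hslope.eventually_lt_const ha).and
    (nhdsWithin_le_nhds (mem_interior_iff_mem_nhds.1 hX))).and self_mem_nhdsWithin).exists
  exact ⟨t, ht, htX, by simpa [div_eq_inv_mul] using hta⟩

variable [IsProbabilityMeasure P] [IsProbabilityMeasure Q]

lemma integrable_of_klDiv_ne_top (h : klDiv P Q ≠ ⊤) (hX : 0 ∈ interior (integrableExpSet X Q)) :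
    Integrable X P := by
  obtain ⟨hac, hllr⟩ := klDiv_ne_top_iff.1 h
  obtain ⟨t, ht, hexp⟩ := exists_integrable_exp_mul_abs hX
  have hmeas : AEMeasurable X Q := aemeasurable_of_mem_interior_integrableExpSet hX
  suffices Integrable (fun x => t * X x) P by
    simpa only [inv_mul_cancel_left₀ (ne_of_gt ht)] using this.const_mul t⁻¹
  rw [← integrable_rnDeriv_smul_iff hac]
  have hkl : Integrable (fun x => klFun (P.rnDeriv Q x).toReal) Q :=
    (integrable_klFun_rnDeriv_iff hac).2 hllr
  refine (hkl.add (hexp.sub (integrable_const 1))).mono'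
    ((P.measurable_rnDeriv Q).ennreal_toReal.aestronglyMeasurable.smul
      (hmeas.const_mul t).aestronglyMeasurable) (ae_of_all _ fun x => ?_)
  rw [smul_eq_mul, norm_mul, Real.norm_of_nonneg ENNReal.toReal_nonneg, norm_mul,
    Real.norm_of_nonneg (le_of_lt ht), Real.norm_eq_abs]
  exact mul_le_klFun_add_exp ENNReal.toReal_nonneg _

/-- The entropy of `P` relative to `Q` tilted by `X` is nonnegative. -/
lemma integral_le_klDiv_add_log (h : klDiv P Q ≠ ⊤) (hX : Integrable X P)
    (hexp : Integrable (fun x => Real.exp (X x)) Q) :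
    ∫ x, X x ∂P ≤ (klDiv P Q).toReal + Real.log (∫ x, Real.exp (X x) ∂Q) := by
  obtain ⟨hac, hllr⟩ := klDiv_ne_top_iff.1 h
  have : IsProbabilityMeasure (Q.tilted X) := isProbabilityMeasure_tilted hexp
  have hnonneg := integral_llr_add_sub_measure_univ_nonneg
    (hac.trans (absolutelyContinuous_tilted hexp)) (integrable_llr_tilted_right hac hX hllr hexp)
  rw [integral_llr_tilted_right hac hX hexp hllr, probReal_univ, probReal_univ] at hnonneg
  rw [toReal_klDiv_of_measure_eq hac (by simp)]
  linarith

lemma integral_le_klDiv_add_log_of_le_smul (h : klDiv P Q ≠ ⊤) (hC : 0 < C)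
    (hle : Q ≤ ENNReal.ofReal C • ν) (hX : Integrable X P)
    (hexp : Integrable (fun x => Real.exp (X x)) ν) :
    ∫ x, X x ∂P ≤ (klDiv P Q).toReal + (Real.log C + Real.log (∫ x, Real.exp (X x) ∂ν)) := by
  have hexp' := hexp.smul_measure (c := ENNReal.ofReal C) ENNReal.ofReal_ne_top
  have hQ : 0 < ∫ x, Real.exp (X x) ∂Q := integral_exp_pos (hexp'.mono_measure hle)
  have hmono : ∫ x, Real.exp (X x) ∂Q ≤ C * ∫ x, Real.exp (X x) ∂ν := by
    have := integral_mono_measure hle (ae_of_all _ fun _ => (Real.exp_pos _).le) hexp'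
    rwa [integral_smul_measure, ENNReal.toReal_ofReal hC.le, smul_eq_mul] at this
  rw [← Real.log_mul hC.ne' (right_ne_zero_of_mul (hQ.trans_le hmono).ne')]
  exact (integral_le_klDiv_add_log h hX (hexp'.mono_measure hle)).trans (by gcongr)

end DonskerVaradhan

section Blocks

/-- The grouping of `b * k` coordinates into `b` consecutive blocks of length `k`. -/
def blocks (b k : ℕ) : (Fin (b * k) → ℝ) ≃ᵐ (Fin b → Fin k → ℝ) :=
  (MeasurableEquiv.piCongrLeft (fun _ => ℝ) finProdFinEquiv.symm).trans
    (MeasurableEquiv.curry (Fin b) (Fin k) ℝ)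

lemma blocks_apply {b k : ℕ} (x : Fin (b * k) → ℝ) (i : Fin b) (j : Fin k) :
    blocks b k x i j = x (finProdFinEquiv (i, j)) := by
  change Equiv.piCongrLeft (fun _ => ℝ) finProdFinEquiv.symm x (i, j) = _
  rw [Equiv.piCongrLeft_apply]
  simp

variable (μ : Measure ℝ) [IsProbabilityMeasure μ] {b k : ℕ}

lemma measurePreserving_blocks (b k : ℕ) :
    MeasurePreserving (blocks b k) (tensorPower μ (b * k))
      (Measure.pi fun _ => tensorPower μ k) := by
  have hcurry : MeasurePreserving (MeasurableEquiv.curry (Fin b) (Fin k) ℝ)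
      (Measure.pi fun _ : Fin b × Fin k => μ) (Measure.pi fun _ => tensorPower μ k) := by
    refine ⟨MeasurableEquiv.measurable _, ?_⟩
    simpa only [Measure.infinitePi_eq_pi, tensorPower] using
      Measure.infinitePi_map_curry fun (_ : Fin b) (_ : Fin k) => μ
  exact hcurry.comp (measurePreserving_piCongrLeft (α := fun _ => ℝ) (fun _ => μ)
    (finProdFinEquiv (m := b) (n := k)).symm)

variable {μ} {φ : (Fin k → ℝ) → ℝ} {t : ℝ}

lemma exp_mul_sum_blocks (φ : (Fin k → ℝ) → ℝ) (t : ℝ) :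
    (fun x => Real.exp (t * ∑ i, φ (blocks b k x i))) =
      (fun y : Fin b → Fin k → ℝ => ∏ i, Real.exp (t * φ (y i))) ∘ blocks b k := by
  ext x
  simp only [Function.comp_apply, Finset.mul_sum, Real.exp_sum]

lemma mem_integrableExpSet_sum_blocks (ht : t ∈ integrableExpSet φ (tensorPower μ k)) :
    t ∈ integrableExpSet (fun x => ∑ i, φ (blocks b k x i)) (tensorPower μ (b * k)) := by
  rw [integrableExpSet, Set.mem_ofPred_eq, exp_mul_sum_blocks,
    (measurePreserving_blocks μ b k).integrable_comp_emb (blocks b k).measurableEmbedding]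
  exact Integrable.fintype_prod fun _ => ht

lemma cgf_sum_blocks (μ : Measure ℝ) [IsProbabilityMeasure μ] (φ : (Fin k → ℝ) → ℝ) (t : ℝ) :
    cgf (fun x => ∑ i, φ (blocks b k x i)) (tensorPower μ (b * k)) t =
      b * cgf φ (tensorPower μ k) t := by
  rw [cgf, mgf, exp_mul_sum_blocks, Function.comp_def,
    (measurePreserving_blocks μ b k).integral_comp'
      (fun y : Fin b → Fin k → ℝ => ∏ i, Real.exp (t * φ (y i))),
    integral_fintype_prod_eq_pow (fun y => Real.exp (t * φ y)), Fintype.card_fin, Real.log_pow, cgf,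
    mgf]

end Blocks

section Marginal

open InformationTheory

variable {N k b n : ℕ} {P Q : Measure (KacSphere N)} {φ : (Fin k → ℝ) → ℝ}

lemma isProbabilityMeasure_marginal [IsProbabilityMeasure P] (hk : k ≤ N) :
    IsProbabilityMeasure (marginal k P) := by
  rw [marginal, dif_pos hk]
  exact Measure.isProbabilityMeasure_map (measurable_coords _).aemeasurable

lemma klDiv_marginal_le [IsFiniteMeasure P] [IsFiniteMeasure Q] (hn : n ≤ N) :
    klDiv (marginal n P) (marginal n Q) ≤ klDiv P Q := by
  rw [marginal, marginal, dif_pos hn, dif_pos hn]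
  exact klDiv_map_le P Q (measurable_coords _)

lemma map_coords_eq_marginal (hP : IsSymm P) (hk : k ≤ N) {e : Fin k → Fin N}
    (he : Function.Injective e) : P.map (fun v j => v.1 (e j)) = marginal k P := by
  have := Equiv.Perm.isMultiplyPretransitive (Fin N) k
  obtain ⟨τ, hτ⟩ := MulAction.exists_smul_eq (Equiv.Perm (Fin N))
    (⟨Fin.castLE hk, Fin.castLE_injective hk⟩ : Fin k ↪ Fin N) ⟨e, he⟩
  have hτe : ∀ j, τ (Fin.castLE hk j) = e j := DFunLike.congr_fun hτ
  have hmap := congrArg (Measure.map fun (x : Fin N → ℝ) j => x (Fin.castLE hk j)) (hP τ)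
  rw [Measure.map_map (by fun_prop) (measurable_coords _),
    Measure.map_map (by fun_prop) (measurable_coords _)] at hmap
  rw [marginal, dif_pos hk]
  simpa only [Function.comp_def, hτe] using hmap

lemma measurePreserving_blocks_marginal (hP : IsSymm P) (hbk : b * k ≤ N) (i : Fin b) :
    MeasurePreserving (fun x => blocks b k x i) (marginal (b * k) P) (marginal k P) := by
  have hmeas : Measurable fun x => blocks b k x i :=
    (measurable_pi_apply i).comp (blocks b k).measurable
  refine ⟨hmeas, ?_⟩
  rw [marginal, dif_pos hbk, Measure.map_map hmeas (measurable_coords _), ← map_coords_eq_marginal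
    hP ((Nat.le_mul_of_pos_left k i.pos).trans hbk) (e := fun j => Fin.castLE hbk
      (finProdFinEquiv (i, j))) fun j j' h => by simpa using h]
  congr 1
  ext v j
  exact blocks_apply _ i j

lemma integrable_sum_blocks (hP : IsSymm P) (hbk : b * k ≤ N) (hφ : Integrable φ (marginal k P)) :
    Integrable (fun x => ∑ i, φ (blocks b k x i)) (marginal (b * k) P) :=
  integrable_finsetSum _ fun i _ =>
    (measurePreserving_blocks_marginal hP hbk i).integrable_comp_of_integrable hφ

lemma integral_sum_blocks (hP : IsSymm P) (hbk : b * k ≤ N) (hφ : Integrable φ (marginal k P)) :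
    ∫ x, ∑ i, φ (blocks b k x i) ∂(marginal (b * k) P) = b * ∫ x, φ x ∂(marginal k P) := by
  have hblock := measurePreserving_blocks_marginal hP hbk
  have integral_block (i : Fin b) :
      ∫ x, φ (blocks b k x i) ∂(marginal (b * k) P) = ∫ x, φ x ∂(marginal k P) := by
    rw [← (hblock i).map_eq, integral_map (hblock i).measurable.aemeasurable
      ((hblock i).map_eq ▸ hφ.aestronglyMeasurable)]
  have integrable_block (i : Fin b) :
      Integrable (fun x => φ (blocks b k x i)) (marginal (b * k) P) :=
    (hblock i).integrable_comp_of_integrable hφ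
  rw [integral_finsetSum _ fun i _ => integrable_block i]
  simp only [integral_block, Finset.sum_const, Finset.card_univ, Fintype.card_fin, nsmul_eq_mul]

variable [IsProbabilityMeasure P] [IsProbabilityMeasure Q] {μ : Measure ℝ} {C t : ℝ}

lemma integrable_marginal_of_klDiv_ne_top (hk : k ≤ N) (hkl : klDiv P Q ≠ ⊤)
    (hle : marginal k Q ≤ ENNReal.ofReal C • tensorPower μ k)
    (hφ : 0 ∈ interior (integrableExpSet φ (tensorPower μ k))) : Integrable φ (marginal k P) :=
  have := isProbabilityMeasure_marginal (P := P) hk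
  have := isProbabilityMeasure_marginal (P := Q) hk
  integrable_of_klDiv_ne_top (ne_top_of_le_ne_top hkl (klDiv_marginal_le hk))
    (interior_mono (integrableExpSet_subset_of_le_smul hle) hφ)

/-- Apply the Donsker–Varadhan inequality to the sum over `b` disjoint blocks: by symmetry each
block contributes equally, so the entropy is divided by the number of blocks. -/
lemma integral_marginal_le [IsProbabilityMeasure μ] (hP : IsSymm P) (hbk : b * k ≤ N) (hb : 0 < b)
    (hkl : klDiv P Q ≠ ⊤) (hC : 0 < C)
    (hle : marginal (b * k) Q ≤ ENNReal.ofReal C • tensorPower μ (b * k))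
    (hφ : Integrable φ (marginal k P)) (ht : 0 < t)
    (hexp : t ∈ integrableExpSet φ (tensorPower μ k)) :
    ∫ x, φ x ∂(marginal k P) ≤
      (((klDiv P Q).toReal + Real.log C) / b + cgf φ (tensorPower μ k) t) / t := by
  have := isProbabilityMeasure_marginal (P := P) hbk
  have := isProbabilityMeasure_marginal (P := Q) hbk
  have donskerVaradhan := integral_le_klDiv_add_log_of_le_smul
    (ne_top_of_le_ne_top hkl (klDiv_marginal_le hbk)) hC hle
    ((integrable_sum_blocks hP hbk hφ).const_mul t) (mem_integrableExpSet_sum_blocks hexp)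
  have hmarginal := ENNReal.toReal_mono hkl (klDiv_marginal_le (P := P) (Q := Q) hbk)
  have hcgf := cgf_sum_blocks (b := b) μ φ t
  rw [cgf, mgf] at hcgf
  rw [integral_const_mul, integral_sum_blocks hP hbk hφ, hcgf] at donskerVaradhan
  have hb' : (0 : ℝ) < b := by exact_mod_cast hb
  rw [le_div_iff₀ ht, div_add' _ _ _ hb'.ne', le_div_iff₀ hb']
  linarith

end Marginal

section SubexpDominated

open InformationTheory

lemma eventually_ne_top_of_tendsto_div {u : ℕ → ℝ≥0∞}
    (hu : Tendsto (fun N : ℕ => u N / (N : ℝ≥0∞)) atTop (𝓝 0)) : ∀ᶠ N in atTop, u N ≠ ⊤ := by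
  filter_upwards [hu.eventually_lt_const ENNReal.zero_lt_top] with N hN h
  simp [h, ENNReal.top_div_of_ne_top (ENNReal.natCast_ne_top N)] at hN

lemma tendsto_toReal_div_natCast {u : ℕ → ℝ≥0∞}
    (hu : Tendsto (fun N : ℕ => u N / (N : ℝ≥0∞)) atTop (𝓝 0)) :
    Tendsto (fun N : ℕ => (u N).toReal / N) atTop (𝓝 0) := by
  simpa [Function.comp_def, ENNReal.toReal_div] using
    (ENNReal.tendsto_toReal ENNReal.zero_ne_top).comp hu

lemma tendsto_natDiv_div (d : ℕ) :
    Tendsto (fun N : ℕ => ((N / d : ℕ) : ℝ) / N) atTop (𝓝 (d : ℝ)⁻¹) := by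
  have h := (tendsto_nat_floor_mul_div_atTop (R := ℝ) (inv_nonneg.2 d.cast_nonneg)).comp
    tendsto_natCast_atTop_atTop
  refine h.congr fun N => ?_
  rw [Function.comp_apply, inv_mul_eq_div, Nat.floor_div_eq_div]

/-- The probability measures `Q N` have marginals dominated by tensor powers of `μ` up to a
subexponential factor. The marginals of nearly full order need not be dominated: those of the
measures `condProd f N` are singular. -/
structure SubexpDominated (μ : Measure ℝ) (Q : (N : ℕ) → Measure (KacSphere N)) : Prop where
  prob : ∀ᶠ N in atTop, IsProbabilityMeasure (Q N)
  marginal_le : ∃ (d : ℕ) (C : ℕ → ℝ), (∀ᶠ N in atTop, 0 < C N) ∧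
    Tendsto (fun N : ℕ => Real.log (C N) / N) atTop (𝓝 0) ∧
    ∀ᶠ N in atTop, ∀ n, n + d ≤ N → marginal n (Q N) ≤ ENNReal.ofReal (C N) • tensorPower μ n

namespace SubexpDominated

variable {μ : Measure ℝ} [IsProbabilityMeasure μ] {Q m : (N : ℕ) → Measure (KacSphere N)}
  {k N₁ : ℕ} {φ : (Fin k → ℝ) → ℝ}

lemma eventually_integral_marginal_lt (hQ : SubexpDominated μ Q) (hk : 0 < k)
    (hm : IsSymmFamily N₁ m)
    (hkl : Tendsto (fun N : ℕ => klDiv (m N) (Q N) / (N : ℝ≥0∞)) atTop (𝓝 0))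
    (hφ : 0 ∈ interior (integrableExpSet φ (tensorPower μ k))) {a : ℝ}
    (ha : ∫ x, φ x ∂(tensorPower μ k) < a) :
    ∀ᶠ N in atTop, Integrable φ (marginal k (m N)) ∧ ∫ x, φ x ∂(marginal k (m N)) < a := by
  obtain ⟨d, C, hC, hClog, hle⟩ := hQ.marginal_le
  obtain ⟨t, ht, hexp, hta⟩ := exists_cgf_div_lt hφ ha
  -- Half of the coordinates, grouped into blocks of length `k`, already suffice.
  have hlim : Tendsto (fun N : ℕ => (((klDiv (m N) (Q N)).toReal / N + Real.log (C N) / N) /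
      (((N / (2 * k) : ℕ) : ℝ) / N) + cgf φ (tensorPower μ k) t) / t) atTop
      (𝓝 (cgf φ (tensorPower μ k) t / t)) := by
    simpa using ((((tendsto_toReal_div_natCast hkl).add hClog).div (tendsto_natDiv_div (2 * k))
      (by positivity)).add_const (cgf φ (tensorPower μ k) t)).div_const t
  filter_upwards [hlim.eventually_lt_const hta, eventually_ne_top_of_tendsto_div hkl, hQ.prob, hC,
    hle, eventually_ge_atTop N₁, eventually_ge_atTop (2 * k + 2 * d)]
    with N hlt hfin hprob hC hle hN₁ hN
  have := (hm N hN₁).1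
  have hNpos : (0 : ℝ) < N := by exact_mod_cast (by omega : 0 < N)
  have hb : 0 < N / (2 * k) := Nat.div_pos (by omega) (by omega)
  have hbk : 2 * (N / (2 * k) * k) ≤ N := by
    simpa only [mul_left_comm] using Nat.div_mul_le_self N (2 * k)
  have hint : Integrable φ (marginal k (m N)) :=
    integrable_marginal_of_klDiv_ne_top (by omega) hfin (hle k (by omega)) hφ
  refine ⟨hint, (integral_marginal_le (hm N hN₁).2 (by omega) hb hfin hC (hle _ (by omega)) hint ht
    hexp).trans_lt ?_⟩
  rwa [← add_div, div_div_div_cancel_right₀ hNpos.ne'] at hlt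

lemma eventually_integrable_marginal (hQ : SubexpDominated μ Q) (hk : 0 < k)
    (hm : IsSymmFamily N₁ m)
    (hkl : Tendsto (fun N : ℕ => klDiv (m N) (Q N) / (N : ℝ≥0∞)) atTop (𝓝 0))
    (hφ : 0 ∈ interior (integrableExpSet φ (tensorPower μ k))) :
    ∀ᶠ N in atTop, Integrable φ (marginal k (m N)) :=
  (hQ.eventually_integral_marginal_lt hk hm hkl hφ (lt_add_one _)).mono fun _ h => h.1

theorem tendsto_integral_marginal (hQ : SubexpDominated μ Q) (hk : 0 < k) (hm : IsSymmFamily N₁ m)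
    (hkl : Tendsto (fun N : ℕ => klDiv (m N) (Q N) / (N : ℝ≥0∞)) atTop (𝓝 0))
    (hφ : 0 ∈ interior (integrableExpSet φ (tensorPower μ k))) :
    Tendsto (fun N => ∫ x, φ x ∂(marginal k (m N))) atTop (𝓝 (∫ x, φ x ∂(tensorPower μ k))) := by
  refine tendsto_order.2 ⟨fun a ha => ?_, fun a ha =>
    (hQ.eventually_integral_marginal_lt hk hm hkl hφ ha).mono fun _ h => h.2⟩
  filter_upwards [hQ.eventually_integral_marginal_lt hk hm hkl
    (zero_mem_interior_integrableExpSet_neg hφ) (a := -a) (by simpa [integral_neg] using ha)]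
    with N hN
  simpa [integral_neg] using hN.2

theorem isChaotic_of_tendsto_klDiv (hQ : SubexpDominated μ Q) (hm : IsSymmFamily N₁ m)
    (hkl : Tendsto (fun N : ℕ => klDiv (m N) (Q N) / (N : ℝ≥0∞)) atTop (𝓝 0)) :
    IsChaotic μ N₁ m where
  symm := hm
  tendsto k hk χ := by
    refine hQ.tendsto_integral_marginal hk hm hkl ?_
    have : integrableExpSet χ (tensorPower μ k) = Set.univ := by
      refine Set.eq_univ_of_forall fun t => Integrable.of_bound (C := Real.exp (|t| * ‖χ‖))
        (by have := χ.continuous; exact Continuous.aestronglyMeasurable (by fun_prop))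
        (ae_of_all _ fun x => ?_)
      rw [Real.norm_of_nonneg (Real.exp_pos _).le, Real.exp_le_exp]
      refine (le_abs_self _).trans ?_
      rw [abs_mul]
      exact mul_le_mul_of_nonneg_left (χ.norm_coe_le_norm x) (abs_nonneg t)
    rw [this, interior_univ]
    exact Set.mem_univ _

end SubexpDominated

end SubexpDominated

section ReferenceMeasure

open InformationTheory

variable {α : Type*} {mα : MeasurableSpace α} {P R : Measure α} {q : α → ℝ≥0∞}

lemma llr_ae_eq_llr_withDensity_add [SigmaFinite P] [SigmaFinite R] (hq : Measurable q)
    (hq_top : ∀ x, q x ≠ ∞) [SigmaFinite (R.withDensity q)] (hac : P ≪ R.withDensity q) :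
    llr P R =ᵐ[P] fun x => llr P (R.withDensity q) x + Real.log (q x).toReal := by
  have hacR : R.withDensity q ≪ R := withDensity_absolutelyContinuous _ _
  have hPR := hac.trans hacR
  filter_upwards [hPR.ae_le (Measure.rnDeriv_mul_rnDeriv hac (κ := R)),
    hPR.ae_le (Measure.rnDeriv_withDensity R hq), hac.ae_le (Measure.rnDeriv_pos hacR),
    Measure.rnDeriv_pos hac, hac.ae_le (Measure.rnDeriv_lt_top P (R.withDensity q))]
    with x hchain hdens hq_pos hpos hlt
  rw [llr, llr, ← hchain, Pi.mul_apply, ENNReal.toReal_mul, hdens, Real.log_mul]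
  · exact (ENNReal.toReal_pos hpos.ne' hlt.ne).ne'
  · exact (ENNReal.toReal_pos (hdens ▸ hq_pos.ne') (hq_top x)).ne'

lemma klDiv_eq_klDiv_withDensity_add [IsProbabilityMeasure P] [IsProbabilityMeasure R]
    (hq : Measurable q) (hq_top : ∀ x, q x ≠ ∞) [IsProbabilityMeasure (R.withDensity q)]
    (hkl : klDiv P (R.withDensity q) ≠ ∞)
    (hlog : Integrable (fun x => Real.log (q x).toReal) P) :
    klDiv P R = ENNReal.ofReal
      ((klDiv P (R.withDensity q)).toReal + ∫ x, Real.log (q x).toReal ∂P) := by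
  obtain ⟨hac, hllr⟩ := klDiv_ne_top_iff.1 hkl
  have hae := llr_ae_eq_llr_withDensity_add hq hq_top hac
  rw [klDiv_of_ac_of_integrable (hac.trans (withDensity_absolutelyContinuous _ _))
      ((hllr.add hlog).congr hae.symm),
    toReal_klDiv_of_measure_eq hac (by simp), integral_congr_ae hae, integral_add hllr hlog]
  simp

end ReferenceMeasure

section LogDensity

variable {f : ℝ → ℝ}

lemma ae_density_pos (hf : Measurable f) : ∀ᵐ v ∂density f, 0 < f v := by
  rw [density, ae_withDensity_iff hf.ennreal_ofReal]
  exact ae_of_all _ fun v hv => ENNReal.ofReal_pos.1 (pos_iff_ne_zero.2 hv)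

lemma sqrt_le_half_add {x : ℝ} (hx : 0 ≤ x) (v : ℝ) :
    √x ≤ (x + x * v ^ 2 + (1 + v ^ 2)⁻¹) / 2 := by
  have square : 0 ≤ (√x * (1 + v ^ 2) - 1) ^ 2 / (1 + v ^ 2) := by positivity
  have expand : (√x * (1 + v ^ 2) - 1) ^ 2 / (1 + v ^ 2) =
      √x ^ 2 * (1 + v ^ 2) + (1 + v ^ 2)⁻¹ - 2 * √x := by
    field_simp
    ring
  rw [Real.sq_sqrt hx] at expand
  linarith

namespace IsKacDensity

variable (hf : IsKacDensity f)

include hf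

lemma integrable_sqrt : Integrable fun v => √(f v) := by
  refine (((hf.integrable.add hf.integrable_two).add integrable_inv_one_add_sq).div_const 2).mono'
    hf.measurable.sqrt.aestronglyMeasurable (ae_of_all _ fun v => ?_)
  rw [Real.norm_of_nonneg (Real.sqrt_nonneg _)]
  exact sqrt_le_half_add (hf.nonneg v) v

lemma half_mem_integrableExpSet_log :
    1 / 2 ∈ integrableExpSet (fun v => Real.log (f v)) (density f) := by
  obtain ⟨M, hM⟩ := hf.bdd
  have hsqrt : Integrable (fun v => √(f v)) (density f) := by
    refine hf.integrable_density_iff.2 <| hf.integrable.mul_bdd (c := √M)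
      hf.measurable.sqrt.aestronglyMeasurable (ae_of_all _ fun v => ?_)
    rw [Real.norm_of_nonneg (Real.sqrt_nonneg _)]
    exact Real.sqrt_le_sqrt (hM v)
  refine hsqrt.congr ?_
  filter_upwards [ae_density_pos hf.measurable] with v hv
  rw [Real.sqrt_eq_rpow, Real.rpow_def_of_pos hv, mul_comm]

lemma neg_half_mem_integrableExpSet_log :
    -(1 / 2) ∈ integrableExpSet (fun v => Real.log (f v)) (density f) := by
  have hinv : Integrable (fun v => (√(f v))⁻¹) (density f) := by
    refine hf.integrable_density_iff.2 (hf.integrable_sqrt.congr (ae_of_all _ fun v => ?_))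
    exact (Real.div_sqrt (x := f v)).symm
  refine hinv.congr ?_
  filter_upwards [ae_density_pos hf.measurable] with v hv
  rw [Real.sqrt_eq_rpow, ← Real.rpow_neg hv.le, Real.rpow_def_of_pos hv, mul_comm]

lemma zero_mem_interior_integrableExpSet_log :
    0 ∈ interior (integrableExpSet (fun v => Real.log (f v)) (density f)) := by
  rw [mem_interior_iff_mem_nhds]
  exact mem_of_superset (Icc_mem_nhds (by norm_num) (by norm_num))
    (convex_integrableExpSet.ordConnected.out hf.neg_half_mem_integrableExpSet_log
      hf.half_mem_integrableExpSet_log)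

lemma integrable_log : Integrable (fun v => Real.log (f v)) (density f) :=
  memLp_one_iff_integrable.1
    (memLp_of_mem_interior_integrableExpSet hf.zero_mem_interior_integrableExpSet_log 1)

end IsKacDensity

end LogDensity

section Gaussian

lemma isKacDensity_gaussianPDFReal : IsKacDensity (gaussianPDFReal 0 1) where
  measurable := measurable_gaussianPDFReal 0 1
  nonneg := gaussianPDFReal_nonneg 0 1
  bdd := ⟨(√(2 * π * (1 : ℝ≥0)))⁻¹, fun v => by
    rw [gaussianPDFReal, neg_div]
    exact mul_le_of_le_one_right (by positivity)
      (Real.exp_le_one_iff.2 (neg_nonpos.2 (by positivity)))⟩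
  one := integral_gaussianPDFReal_eq_one 0 one_ne_zero
  two := by
    have h := variance_id_gaussianReal (μ := 0) (v := 1)
    rw [variance_eq_integral measurable_id.aemeasurable] at h
    simp only [id, integral_id_gaussianReal, sub_zero] at h
    rw [integral_gaussianReal_eq_integral_smul one_ne_zero] at h
    simpa using h
  four := by
    have h := (memLp_id_gaussianReal (μ := 0) (v := 1) 4).integrable_norm_pow (by norm_num)
    rw [gaussianReal_of_var_ne_zero 0 one_ne_zero, integrable_withDensity_iff
      (measurable_gaussianPDF 0 1) (ae_of_all _ fun _ => ENNReal.ofReal_lt_top)] at h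
    refine h.congr (ae_of_all _ fun v => ?_)
    simp only [id, gaussianPDF, ENNReal.toReal_ofReal (gaussianPDFReal_nonneg 0 1 v),
      Real.norm_eq_abs, Even.pow_abs (by decide : Even 4), mul_comm]

lemma gaussianPDFReal_eq_mul_exp (v : ℝ) :
    gaussianPDFReal 0 1 v = gaussianPDFReal 0 1 1 * Real.exp ((1 - v ^ 2) / 2) := by
  rw [gaussianPDFReal, gaussianPDFReal, mul_assoc _ (Real.exp _), ← Real.exp_add]
  congr 2
  simp only [sub_zero, NNReal.coe_one]
  ring

lemma log_gaussianPDFReal (v : ℝ) :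
    Real.log (gaussianPDFReal 0 1 v) = Real.log (gaussianPDFReal 0 1 1) + (1 - v ^ 2) / 2 := by
  rw [gaussianPDFReal_eq_mul_exp, Real.log_mul (gaussianPDFReal_pos 0 1 1 one_ne_zero).ne'
    (Real.exp_pos _).ne', Real.log_exp]

lemma sum_sq_coord {N : ℕ} (v : KacSphere N) : ∑ j, v.1 j ^ 2 = N := by
  have h := norm_eq_of_mem_sphere v
  rw [EuclideanSpace.norm_eq, Real.sqrt_inj (by positivity) (by positivity)] at h
  simpa using h

lemma prod_gaussianPDFReal_coord {N : ℕ} (v : KacSphere N) :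
    ∏ j, gaussianPDFReal 0 1 (v.1 j) = gaussianPDFReal 0 1 1 ^ N := by
  rw [Finset.prod_congr rfl fun j _ => gaussianPDFReal_eq_mul_exp (v.1 j), Finset.prod_mul_distrib,
    ← Real.exp_sum, ← Finset.sum_div, Finset.sum_sub_distrib, sum_sq_coord]
  simp

lemma toReal_Z_gaussianPDFReal {N : ℕ} (hN : N ≠ 0) :
    (Z (gaussianPDFReal 0 1) N).toReal = gaussianPDFReal 0 1 1 ^ N := by
  have := isProbabilityMeasure_unif hN
  simp only [Z, ← ENNReal.ofReal_prod_of_nonneg fun _ _ => gaussianPDFReal_nonneg 0 1 _,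
    prod_gaussianPDFReal_coord, lintegral_const, measure_univ, mul_one]
  exact ENNReal.toReal_ofReal (pow_nonneg (gaussianPDFReal_nonneg 0 1 1) N)

lemma withDensity_gaussianReal_div {f : ℝ → ℝ} (hf : Measurable f) :
    ((gaussianReal 0 1).withDensity fun v => ENNReal.ofReal (f v / gaussianPDFReal 0 1 v)) =
      density f := by
  have := measurable_gaussianPDFReal 0 1
  rw [gaussianReal_of_var_ne_zero 0 one_ne_zero,
    ← withDensity_mul _ (measurable_gaussianPDF 0 1) (by fun_prop), density]
  congr 1
  ext v
  have hpos := gaussianPDFReal_pos 0 1 v one_ne_zero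
  rw [Pi.mul_apply, gaussianPDF, ← ENNReal.ofReal_mul hpos.le, mul_div_cancel₀ _ hpos.ne']

lemma klDiv_density_gaussianReal {f : ℝ → ℝ} (hf : IsKacDensity f) :
    InformationTheory.klDiv (density f) (gaussianReal 0 1) =
      ENNReal.ofReal (∫ v, Real.log (f v) ∂density f - Real.log (gaussianPDFReal 0 1 1)) := by
  have := hf.isProbabilityMeasure
  have := measurable_gaussianPDFReal 0 1
  have := hf.measurable
  have hdens := withDensity_gaussianReal_div hf.measurable
  have hlog : (fun v => Real.log (ENNReal.ofReal (f v / gaussianPDFReal 0 1 v)).toReal)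
      =ᵐ[density f] fun v =>
        Real.log (f v) - (Real.log (gaussianPDFReal 0 1 1) + (1 - v ^ 2) / 2) := by
    filter_upwards [ae_density_pos hf.measurable] with v hv
    have hpos := gaussianPDFReal_pos 0 1 v one_ne_zero
    rw [ENNReal.toReal_ofReal (div_pos hv hpos).le, Real.log_div hv.ne' hpos.ne',
      log_gaussianPDFReal]
  have hsq : Integrable (fun v : ℝ => v ^ 2) (density f) :=
    hf.integrable_density_iff.2 hf.integrable_two
  have hquad : Integrable (fun v : ℝ => (1 - v ^ 2) / 2) (density f) :=
    ((integrable_const 1).sub hsq).div_const 2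
  have hrest : Integrable (fun v : ℝ => Real.log (gaussianPDFReal 0 1 1) + (1 - v ^ 2) / 2)
      (density f) := (integrable_const _).add hquad
  have hquad_zero : ∫ v : ℝ, (1 - v ^ 2) / 2 ∂density f = 0 := by
    rw [integral_div, integral_sub (integrable_const 1) hsq, hf.integral_density fun v => v ^ 2,
      hf.two]
    simp
  have : IsProbabilityMeasure ((gaussianReal 0 1).withDensity fun v =>
      ENNReal.ofReal (f v / gaussianPDFReal 0 1 v)) := by rwa [hdens]
  rw [klDiv_eq_klDiv_withDensity_add (by fun_prop) (fun _ => ENNReal.ofReal_ne_top)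
      (by simp [hdens, InformationTheory.klDiv_self])
      ((hf.integrable_log.sub hrest).congr hlog.symm),
    hdens, InformationTheory.klDiv_self, integral_congr_ae hlog,
    integral_sub hf.integrable_log hrest,
    integral_add (integrable_const _) hquad, hquad_zero]
  simp

end Gaussian

section NormalizationRate

variable {f g : ℝ → ℝ}

/-- Both densities obey the same local limit theorem up to the variance, and the geometric factor
`sliceConst` cancels. -/
lemma exists_tendsto_Z_div_Z (hf : IsKacDensity f) (hg : IsKacDensity g) :
    ∃ L > 0, Tendsto (fun N => (Z f N).toReal / (Z g N).toReal) atTop (𝓝 L) := by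
  have hf_var := hf.variance_sqLaw_pos
  have hg_var := hg.variance_sqLaw_pos
  have hlim := (tendsto_sqrt_mul_sumSqDensity hf 1).div (tendsto_sqrt_mul_sumSqDensity hg 1)
    (by positivity)
  refine ⟨_, by positivity, (tendsto_add_atTop_iff_nat 1).1 (hlim.congr' ?_)⟩
  filter_upwards [eventually_gt_atTop 0] with n hn
  have hsqrt : √(n : ℝ) ≠ 0 := by positivity
  have hslice : (sliceConst n).toReal ≠ 0 :=
    ENNReal.toReal_ne_zero.2 ⟨sliceConst_ne_zero n, sliceConst_ne_top n⟩
  rw [Z_succ hf.measurable, Z_succ hg.measurable, ENNReal.toReal_mul, ENNReal.toReal_mul,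
    mul_div_mul_left _ _ hslice, Pi.div_apply, mul_div_mul_left _ _ hsqrt, Nat.cast_succ]

theorem tendsto_log_Z_div (hf : IsKacDensity f) :
    Tendsto (fun N : ℕ => Real.log (Z f N).toReal / N) atTop
      (𝓝 (Real.log (gaussianPDFReal 0 1 1))) := by
  obtain ⟨L, hL, hlim⟩ := exists_tendsto_Z_div_Z hf isKacDensity_gaussianPDFReal
  have hlog := (((hlim.log hL.ne').div_atTop tendsto_natCast_atTop_atTop).add_const
    (Real.log (gaussianPDFReal 0 1 1)))
  rw [zero_add] at hlog
  refine hlog.congr' ?_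
  filter_upwards [eventually_Z_pos_lt_top hf, eventually_gt_atTop 0] with N ⟨hZ, hZtop⟩ hN
  rw [toReal_Z_gaussianPDFReal hN.ne', Real.log_div (ENNReal.toReal_pos hZ.ne' hZtop.ne).ne'
    (pow_pos (gaussianPDFReal_pos 0 1 1 one_ne_zero) N).ne', Real.log_pow]
  field_simp
  ring

end NormalizationRate

section Entropy

open InformationTheory

variable {N : ℕ} {P : Measure (KacSphere N)} {f : ℝ → ℝ}

lemma measurePreserving_coord_marginal (hP : IsSymm P) (j : Fin N) :
    MeasurePreserving (fun (v : KacSphere N) (_ : Fin 1) => v.1 j) P (marginal 1 P) :=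
  ⟨measurable_coords _, map_coords_eq_marginal hP j.pos (Function.injective_of_subsingleton _)⟩

lemma integrable_sum_coord (hP : IsSymm P) {φ : (Fin 1 → ℝ) → ℝ}
    (hφ : Integrable φ (marginal 1 P)) :
    Integrable (fun v : KacSphere N => ∑ j, φ fun _ => v.1 j) P :=
  integrable_finsetSum _ fun j _ =>
    (measurePreserving_coord_marginal hP j).integrable_comp_of_integrable hφ

lemma integral_sum_coord (hP : IsSymm P) {φ : (Fin 1 → ℝ) → ℝ} (hφ : Integrable φ (marginal 1 P)) :
    ∫ v : KacSphere N, ∑ j, φ (fun _ => v.1 j) ∂P = N * ∫ x, φ x ∂marginal 1 P := by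
  have hcoord := measurePreserving_coord_marginal hP
  have integrable_coord (j : Fin N) : Integrable (fun v : KacSphere N => φ fun _ => v.1 j) P :=
    (hcoord j).integrable_comp_of_integrable hφ
  have integral_coord (j : Fin N) :
      ∫ v : KacSphere N, φ (fun _ => v.1 j) ∂P = ∫ x, φ x ∂marginal 1 P := by
    rw [← (hcoord j).map_eq, integral_map (hcoord j).measurable.aemeasurable
      ((hcoord j).map_eq ▸ hφ.aestronglyMeasurable)]
  rw [integral_finsetSum _ fun j _ => integrable_coord j]
  simp only [integral_coord, Finset.sum_const, Finset.card_univ, Fintype.card_fin, nsmul_eq_mul]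

lemma ae_condProd_pos (hf : Measurable f) (N : ℕ) :
    ∀ᵐ v ∂condProd f N, ∀ j, 0 < f (v.1 j) := by
  rw [condProd, ae_withDensity_iff (by fun_prop)]
  refine ae_of_all _ fun v hv j => ENNReal.ofReal_pos.1 (pos_iff_ne_zero.2 ?_)
  exact Finset.prod_ne_zero_iff.1 (ENNReal.div_ne_zero.1 hv).1 j (Finset.mem_univ j)

lemma log_toReal_prod_div_Z (hZ : Z f N ≠ 0) (hZtop : Z f N ≠ ∞) {v : KacSphere N}
    (hv : ∀ j, 0 < f (v.1 j)) :
    Real.log ((∏ j, ENNReal.ofReal (f (v.1 j))) / Z f N).toReal =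
      ∑ j, Real.log (f (v.1 j)) - Real.log (Z f N).toReal := by
  rw [← ENNReal.ofReal_prod_of_nonneg fun j _ => (hv j).le, ENNReal.toReal_div,
    ENNReal.toReal_ofReal (Finset.prod_nonneg fun j _ => (hv j).le),
    Real.log_div (Finset.prod_pos fun j _ => hv j).ne' (ENNReal.toReal_pos hZ hZtop).ne',
    Real.log_prod fun j _ => (hv j).ne']

lemma klDiv_unif_eq [IsProbabilityMeasure P] (hf : Measurable f) (hN : N ≠ 0) (hZ : Z f N ≠ 0)
    (hZtop : Z f N ≠ ∞) (hP : IsSymm P) (hkl : klDiv P (condProd f N) ≠ ∞)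
    (hlog : Integrable (fun x : Fin 1 → ℝ => Real.log (f (x 0))) (marginal 1 P)) :
    klDiv P (unif N) = ENNReal.ofReal ((klDiv P (condProd f N)).toReal +
      (N * ∫ x, Real.log (f (x 0)) ∂marginal 1 P - Real.log (Z f N).toReal)) := by
  have := isProbabilityMeasure_unif hN
  have := isProbabilityMeasure_condProd hZ hZtop
  have hlog_dens : (fun v => Real.log ((∏ j, ENNReal.ofReal (f (v.1 j))) / Z f N).toReal) =ᵐ[P]
      fun v => ∑ j, Real.log (f (v.1 j)) - Real.log (Z f N).toReal := by
    filter_upwards [(klDiv_ne_top_iff.1 hkl).1.ae_le (ae_condProd_pos hf N)] with v hv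
    exact log_toReal_prod_div_Z hZ hZtop hv
  have hsum : Integrable (fun v => ∑ j, Real.log (f (v.1 j))) P := integrable_sum_coord hP hlog
  rw [condProd] at *
  rw [klDiv_eq_klDiv_withDensity_add (by fun_prop) (fun v =>
      ENNReal.div_ne_top (ENNReal.prod_ne_top fun _ _ => ENNReal.ofReal_ne_top) hZ) hkl
      ((hsum.sub (integrable_const _)).congr hlog_dens.symm),
    integral_congr_ae hlog_dens, integral_sub hsum (integrable_const _),
    integral_sum_coord hP hlog]
  simp

lemma tendsto_log_mul_sqrt_div {C : ℝ} (hC : 0 < C) :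
    Tendsto (fun N : ℕ => Real.log (C * √(N : ℝ)) / N) atTop (𝓝 0) := by
  have hlog : Tendsto (fun N : ℕ => Real.log N / (N : ℝ)) atTop (𝓝 0) :=
    Real.isLittleO_log_id_atTop.tendsto_div_nhds_zero.comp tendsto_natCast_atTop_atTop
  have hlim := (tendsto_const_div_atTop_nhds_zero_nat (Real.log C)).add (hlog.div_const 2)
  rw [zero_div, add_zero] at hlim
  refine hlim.congr' ?_
  filter_upwards [eventually_gt_atTop 0] with N hN
  have hN' : (0 : ℝ) < N := by exact_mod_cast hN
  rw [Real.log_mul hC.ne' (Real.sqrt_pos.2 hN').ne', Real.log_sqrt hN'.le]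
  ring

lemma subexpDominated_condProd (hf : IsKacDensity f) :
    SubexpDominated (density f) (condProd f) where
  prob := (eventually_Z_pos_lt_top hf).mono fun _ hZ =>
    isProbabilityMeasure_condProd hZ.1.ne' hZ.2.ne
  marginal_le := by
    obtain ⟨C, hC, hle⟩ := exists_marginal_condProd_le_smul hf
    refine ⟨5, fun N => C * √N, ?_, tendsto_log_mul_sqrt_div hC, hle⟩
    filter_upwards [eventually_gt_atTop 0] with N hN
    positivity

lemma measurePreserving_tensorPower_one (μ : Measure ℝ) :
    MeasurePreserving (MeasurableEquiv.funUnique (Fin 1) ℝ) (tensorPower μ 1) μ :=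
  measurePreserving_funUnique μ (Fin 1)

theorem isEntropicallyChaotic_of_tendsto_klDiv (hf : IsKacDensity f) {N₁ : ℕ}
    {m : (N : ℕ) → Measure (KacSphere N)} (hm : IsSymmFamily N₁ m)
    (hkl : Tendsto (fun N : ℕ => klDiv (m N) (condProd f N) / (N : ℝ≥0∞)) atTop (𝓝 0)) :
    IsEntropicallyChaotic (density f) N₁ m where
  toIsChaotic :=
    have := hf.isProbabilityMeasure
    (subexpDominated_condProd hf).isChaotic_of_tendsto_klDiv hm hkl
  entropy := by
    have := hf.isProbabilityMeasure
    have hone := measurePreserving_tensorPower_one (density f)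
    have hexp : 0 ∈ interior (integrableExpSet (fun x : Fin 1 → ℝ => Real.log (f (x 0)))
        (tensorPower (density f) 1)) := by
      convert hf.zero_mem_interior_integrableExpSet_log using 2
      ext t
      exact hone.integrable_comp_emb (MeasurableEquiv.measurableEmbedding _)
        (g := fun v => Real.exp (t * Real.log (f v)))
    have hlog := (subexpDominated_condProd hf).tendsto_integral_marginal one_pos hm hkl hexp
    have hmean : ∫ x, Real.log (f (x 0)) ∂tensorPower (density f) 1 =
        ∫ v, Real.log (f v) ∂density f := hone.integral_comp' fun v => Real.log (f v)
    rw [hmean] at hlog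
    have hlim := ENNReal.tendsto_ofReal
      ((tendsto_toReal_div_natCast hkl).add (hlog.sub (tendsto_log_Z_div hf)))
    rw [zero_add, ← klDiv_density_gaussianReal hf] at hlim
    refine hlim.congr' ?_
    filter_upwards [(subexpDominated_condProd hf).eventually_integrable_marginal one_pos hm hkl
      hexp, eventually_ne_top_of_tendsto_div hkl, eventually_Z_pos_lt_top hf,
      eventually_ge_atTop N₁, eventually_gt_atTop 0] with N hint hfin ⟨hZ, hZtop⟩ hN₁ hN
    have := (hm N hN₁).1
    have hN' : (0 : ℝ) < N := by exact_mod_cast hN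
    rw [klDiv_unif_eq hf.measurable hN.ne' hZ.ne' hZtop.ne (hm N hN₁).2 hfin hint,
      ← ENNReal.ofReal_natCast N, ← ENNReal.ofReal_div_of_pos hN']
    congr 1
    field_simp

theorem isEntropicallyChaotic_condProd (hf : IsKacDensity f) {N₁ : ℕ}
    (hZ : ∀ N, N₁ ≤ N → 0 < Z f N ∧ Z f N < ∞) :
    IsEntropicallyChaotic (density f) N₁ (condProd f) := by
  have hprob (N : ℕ) (hN : N₁ ≤ N) : IsProbabilityMeasure (condProd f N) :=
    isProbabilityMeasure_condProd (hZ N hN).1.ne' (hZ N hN).2.ne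
  refine isEntropicallyChaotic_of_tendsto_klDiv hf
    (fun N hN => ⟨hprob N hN, isSymm_condProd hf.measurable N⟩) (tendsto_const_nhds.congr' ?_)
  filter_upwards [eventually_ge_atTop N₁] with N hN
  have := hprob N hN
  rw [klDiv_self, ENNReal.zero_div]

end Entropy

section Congruence

variable {f g : ℝ → ℝ}

lemma sliceIntegral_comp_coord_eq_zero {n : ℕ} (i : Fin n) {h : ℝ → ℝ≥0∞} (hh : h =ᵐ[volume] 0)
    (t : ℝ) : sliceIntegral (fun x : Fin (n + 1) → ℝ => h (x i.castSucc)) t = 0 := by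
  refine lintegral_eq_zero_of_ae_eq_zero ?_
  filter_upwards [(Measure.quasiMeasurePreserving_eval (fun _ => volume) i).ae hh] with y hy
  simp [sqDensity, Fin.snoc_castSucc, hy]

lemma quasiMeasurePreserving_coord {N : ℕ} (hN : 2 ≤ N) (j : Fin N) :
    Measure.QuasiMeasurePreserving (fun v : KacSphere N => v.1 j) (unif N) volume := by
  refine ⟨measurable_coord j, Measure.AbsolutelyContinuous.mk fun s hs hs_null => ?_⟩
  obtain ⟨n, rfl⟩ : ∃ n, N = n + 2 := ⟨N - 2, by omega⟩
  have hF : Measurable fun x : Fin (n + 2) → ℝ =>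
      s.indicator (1 : ℝ → ℝ≥0∞) (x (0 : Fin (n + 1)).castSucc) :=
    (measurable_one.indicator hs).comp (measurable_pi_apply _)
  rw [Measure.map_apply (measurable_coord j) hs, ← lintegral_indicator_one (measurable_coord j hs)]
  calc ∫⁻ v : KacSphere (n + 2), ((fun v : KacSphere (n + 2) => v.1 j) ⁻¹' s).indicator 1 v
        ∂unif (n + 2)
      = ∫⁻ v : KacSphere (n + 2), s.indicator 1
          (v.1 (Equiv.swap (0 : Fin (n + 1)).castSucc j (0 : Fin (n + 1)).castSucc))
            ∂unif (n + 2) := by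
        simp only [Equiv.swap_apply_left]
        rfl
    _ = 0 := by
        rw [lintegral_unif_comp_perm _ hF, lintegral_unif (n + 1) hF,
          sliceIntegral_comp_coord_eq_zero 0 (indicator_meas_zero hs_null), mul_zero]

lemma density_congr (h : f =ᵐ[volume] g) : density f = density g :=
  withDensity_congr_ae (h.fun_comp ENNReal.ofReal)

lemma prod_coord_ae_eq (h : f =ᵐ[volume] g) {N : ℕ} (hN : 2 ≤ N) :
    (fun v : KacSphere N => ∏ j, ENNReal.ofReal (f (v.1 j))) =ᵐ[unif N]
      fun v => ∏ j, ENNReal.ofReal (g (v.1 j)) := by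
  filter_upwards [ae_all_iff.2 fun j => (quasiMeasurePreserving_coord hN j).ae h] with v hv
  simp only [hv]

lemma Z_congr (h : f =ᵐ[volume] g) {N : ℕ} (hN : 2 ≤ N) : Z f N = Z g N :=
  lintegral_congr_ae (prod_coord_ae_eq h hN)

lemma condProd_congr (h : f =ᵐ[volume] g) {N : ℕ} (hN : 2 ≤ N) : condProd f N = condProd g N := by
  rw [condProd, condProd, Z_congr h hN]
  exact withDensity_congr_ae ((prod_coord_ae_eq h hN).fun_comp (· / Z g N))

lemma IsEntropicallyChaotic.congr {μ : Measure ℝ} {N₁ : ℕ} {m m' : (N : ℕ) → Measure (KacSphere N)}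
    (hm : IsEntropicallyChaotic μ N₁ m) (h : ∀ N, N₁ ≤ N → m N = m' N) :
    IsEntropicallyChaotic μ N₁ m' where
  symm N hN := h N hN ▸ hm.symm N hN
  tendsto k hk χ := (hm.tendsto k hk χ).congr' <| by
    filter_upwards [eventually_ge_atTop N₁] with N hN
    rw [h N hN]
  entropy := hm.entropy.congr' <| by
    filter_upwards [eventually_ge_atTop N₁] with N hN
    rw [h N hN]

lemma exists_measurable_nonneg_bdd_ae_eq (hf_nonneg : 0 ≤ᵐ[volume] f) (hf_bdd : MemLp f ⊤ volume) :
    ∃ g, Measurable g ∧ (∀ v, 0 ≤ g v) ∧ (∃ M, ∀ v, g v ≤ M) ∧ f =ᵐ[volume] g := by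
  let M := (eLpNorm f ⊤ volume).toReal
  let f₁ := hf_bdd.1.mk f
  have hf₁ : Measurable f₁ := hf_bdd.1.stronglyMeasurable_mk.measurable
  refine ⟨fun v => max 0 (min (f₁ v) M), by fun_prop, fun v => le_max_left _ _,
    ⟨M, fun v => max_le ENNReal.toReal_nonneg (min_le_right _ _)⟩, ?_⟩
  filter_upwards [hf_bdd.1.ae_eq_mk, hf_nonneg, ae_le_eLpNormEssSup (f := f) (μ := volume)]
    with v hmk hnonneg hle
  have hM : f v ≤ M := by
    have := ENNReal.toReal_mono hf_bdd.2.ne (eLpNorm_exponent_top (f := f) ▸ hle)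
    rw [toReal_enorm] at this
    exact (Real.le_norm_self _).trans this
  change f v = max 0 (min (hf_bdd.1.mk f v) M)
  rw [← hmk, min_eq_left hM]
  exact (max_eq_right hnonneg).symm

lemma exists_isKacDensity_ae_eq (hf_nonneg : 0 ≤ᵐ[volume] f) (hf_one : ∫ v, f v = 1)
    (hf_two : ∫ v, f v * v ^ 2 = 1) (hf_four : Integrable fun v => f v * v ^ 4)
    (hf_bdd : MemLp f ⊤ volume) : ∃ g, IsKacDensity g ∧ f =ᵐ[volume] g := by
  obtain ⟨g, hg, hg_nonneg, hg_bdd, hfg⟩ := exists_measurable_nonneg_bdd_ae_eq hf_nonneg hf_bdd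
  have hmoment (n : ℕ) : (fun v => f v * v ^ n) =ᵐ[volume] fun v => g v * v ^ n :=
    hfg.mono fun v hv => by simp only [hv]
  exact ⟨g, ⟨hg, hg_nonneg, hg_bdd, integral_congr_ae hfg ▸ hf_one,
    integral_congr_ae (hmoment 2) ▸ hf_two, hf_four.congr (hmoment 4)⟩, hfg⟩

end Congruence

end

end KacChaos

theorem mainTheorem2 (f : ℝ → ℝ)
    (hf_nonneg : 0 ≤ᵐ[MeasureTheory.volume] f)
    (hf_one : ∫ v, f v = 1)
    (hf_two : ∫ v, f v * v ^ 2 = 1)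
    (hf_four : MeasureTheory.Integrable (fun v => f v * v ^ 4) MeasureTheory.volume)
    (hf_bdd : MeasureTheory.MemLp f ⊤ MeasureTheory.volume) :
    (∃ N₀ : ℕ, 1 ≤ N₀ ∧
      (∀ N, N₀ ≤ N → 0 < KacChaos.Z f N ∧ KacChaos.Z f N < ⊤) ∧
      KacChaos.IsEntropicallyChaotic (KacChaos.density f) N₀ (KacChaos.condProd f)) ∧
    (∀ k : ℕ, 0 < k →
      Filter.Tendsto
        (fun N : ℕ => InformationTheory.klDiv (KacChaos.marginal k (KacChaos.condProd f N))
          (KacChaos.tensorPower (KacChaos.density f) k))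
        Filter.atTop (nhds 0)) ∧
    (∀ (N₁ : ℕ) (m : (N : ℕ) → MeasureTheory.Measure (KacChaos.KacSphere N)),
      1 ≤ N₁ → KacChaos.IsSymmFamily N₁ m →
      Filter.Tendsto
        (fun N : ℕ => InformationTheory.klDiv (m N) (KacChaos.condProd f N) / (N : ENNReal))
        Filter.atTop (nhds 0) →
      KacChaos.IsEntropicallyChaotic (KacChaos.density f) N₁ m) := by
  obtain ⟨g, hg, hfg⟩ := KacChaos.exists_isKacDensity_ae_eq hf_nonneg hf_one hf_two hf_four hf_bdd
  obtain ⟨N₀, hZ⟩ := Filter.eventually_atTop.1 (KacChaos.eventually_Z_pos_lt_top hg)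
  have condProd_eq : ∀ᶠ N in Filter.atTop, KacChaos.condProd g N = KacChaos.condProd f N := by
    filter_upwards [Filter.eventually_ge_atTop 2] with N hN
    rw [KacChaos.condProd_congr hfg hN]
  rw [KacChaos.density_congr hfg]
  refine ⟨⟨max N₀ 2, by omega, fun N hN => ?_, ?_⟩, fun k _ => ?_, fun N₁ m _ hm hkl => ?_⟩
  · rw [KacChaos.Z_congr hfg (by omega)]
    exact hZ N (by omega)
  · exact (KacChaos.isEntropicallyChaotic_condProd hg fun N hN => hZ N (by omega)).congr
      fun N hN => (KacChaos.condProd_congr hfg (by omega)).symm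
  · exact (KacChaos.tendsto_klDiv_marginal_condProd hg k).congr'
      (condProd_eq.mono fun N hN => by simp only [hN])
  · exact KacChaos.isEntropicallyChaotic_of_tendsto_klDiv hg hm
      (hkl.congr' (condProd_eq.mono fun N hN => by simp only [hN]))
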